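/- Let $d$ be a natural number, let $F\subseteq\mathbb{R}$ be a set and let $x\in\mathbb{R}^d$. A set $A\subseteq\mathbb{R}^d$ is \emph{algebraic} if it is the zero set of a polynomial in $d$ variables with real coefficients. An algebraic set $A$ is \emph{irreducible} if, whenever $A=B\cup C$ with $B,C$ algebraic, then $B=A$ or $C=A$. For a set $A\subseteq\mathbb{R}^d$ let $I(A)\subseteq\mathbb{R}[X_1,\dots,X_d]$ be the ideal of polynomials vanishing on $A$, and let $\dim A$ be the Krull dimension of $\mathbb{R}[X_1,\dots,X_d]/I(A)$. A point $y\in A$ is a \emph{nonsingular} point of $A$ if the Zariski tangent space $\{v\in\mathbb{R}^d : \sum_i \frac{\partial p}{\partial X_i}(y)\,v_i=0 \text{ for all } p\in I(A)\}$ to $A$ at $y$ has dimension $\dim A$. A set $A\subseteq\mathbb{R}^d$ is \emph{$F$-semialgebraic} if it is of the form $\{z\in\mathbb{R}^d : \mathbb{R}\models\psi(z)\}$ for a first-order formula $\psi$ of the language of ordered rings (the language of real closed fields) with parameters in $F$. Let $D(F,x)$ be the smallest set, with respect to inclusion, among the algebraic sets that are $F$-semialgebraic and contain $x$. Then this smallest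 set exists, and: \begin{enumerate} \item $D(F,x)$ is an irreducible algebraic set; \item $x$ is a nonsingular point of $D(F,x)$; \item if $F$ is a real closed subfield of $\mathbb{R}$, then $D(F,x)=\{x\}$ if and only if $x\in F^d$. \end{enumerate} -/

import Mathlib

open FirstOrder

namespace RealAlg

/-- The first-order language of real closed fields (ordered rings): `+, *, -, 0, 1, ≤`. -/
abbrev rcfLang : Language := Language.ring.sum Language.order

/-- The field operations of `ℝ` as a structure for the language of rings. -/
noncomputable instance ringStructureReal : FirstOrder.Ring.CompatibleRing ℝ :=
  FirstOrder.Ring.compatibleRingOfRing ℝ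

/-- The order of `ℝ` as a structure for the language of orders. Together with the instance above it
makes `ℝ`, the standard ordered field, a structure for `rcfLang`. -/
noncomputable instance orderStructureReal : Language.order.Structure ℝ :=
  Language.orderStructure ℝ

/-- A subset of `ℝ^d` is algebraic if it is the zero set of one polynomial with real
coefficients. -/
def IsAlgebraicSet {d : ℕ} (A : Set (Fin d → ℝ)) : Prop :=
  ∃ p : MvPolynomial (Fin d) ℝ, A = {z | MvPolynomial.eval z p = 0}

/-- An algebraic set is irreducible if it is not the union of two algebraic sets both different
from it. -/
def IsIrreducibleAlgebraicSet {d : ℕ} (A : Set (Fin d → ℝ)) : Prop :=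
  IsAlgebraicSet A ∧
    ∀ B C : Set (Fin d → ℝ), IsAlgebraicSet B → IsAlgebraicSet C → A = B ∪ C → B = A ∨ C = A

/-- The Zariski tangent space to `A ⊆ ℝ^d` at `x`: the vectors annihilated by the differentials
at `x` of all polynomials that vanish on `A`. -/
noncomputable def zariskiTangentSpace {d : ℕ} (A : Set (Fin d → ℝ)) (x : Fin d → ℝ) :
    Submodule ℝ (Fin d → ℝ) where
  carrier := {v | ∀ p ∈ MvPolynomial.vanishingIdeal ℝ A,
    ∑ i, MvPolynomial.eval x (MvPolynomial.pderiv i p) * v i = 0}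
  add_mem' := by
    intro v w hv hw p hp
    simp only [Pi.add_apply, mul_add, Finset.sum_add_distrib, hv p hp, hw p hp, add_zero]
  zero_mem' := by
    intro p _
    simp
  smul_mem' := by
    intro c v hv p hp
    simp only [Pi.smul_apply, smul_eq_mul, mul_left_comm _ c, ← Finset.mul_sum, hv p hp, mul_zero]

/-- The dimension of `A ⊆ ℝ^d`: the Krull dimension of the ring `ℝ[X₁, …, X_d] / I(A)` of
polynomial functions on `A`. -/
noncomputable def algDim {d : ℕ} (A : Set (Fin d → ℝ)) : WithBot ℕ∞ :=
  ringKrullDim (MvPolynomial (Fin d) ℝ ⧸ MvPolynomial.vanishingIdeal ℝ A)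

/-- `x` is a nonsingular point of `A` if it belongs to `A` and the Zariski tangent space to `A`
at `x` has dimension `dim A`. -/
def IsNonsingularPoint {d : ℕ} (A : Set (Fin d → ℝ)) (x : Fin d → ℝ) : Prop :=
  x ∈ A ∧ (Module.finrank ℝ (zariskiTangentSpace A x) : WithBot ℕ∞) = algDim A

/-- A subset of `ℝ^d` is `F`-semialgebraic if it is defined in `ℝ` by a first-order formula of the
language of real closed fields with parameters in `F`. -/
def IsSemialgebraicOver {d : ℕ} (F : Set ℝ) (A : Set (Fin d → ℝ)) : Prop :=
  F.Definable rcfLang A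

/-- The collection of all algebraic subsets of `ℝ^d` that are `F`-semialgebraic and contain `x`. -/
def algebraicDefinableSets {d : ℕ} (F : Set ℝ) (x : Fin d → ℝ) : Set (Set (Fin d → ℝ)) :=
  {A | IsAlgebraicSet A ∧ IsSemialgebraicOver F A ∧ x ∈ A}

/-- `D(F, x)`: the smallest `F`-semialgebraic set containing `x` that is algebraic. A smallest
member of a collection of sets is its intersection. -/
def D {d : ℕ} (F : Set ℝ) (x : Fin d → ℝ) : Set (Fin d → ℝ) :=
  ⋂₀ algebraicDefinableSets F x

end RealAlg

/-!
Let `k` be the subring of `ℝ` generated by `F`. After a choice of a maximal algebraically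
independent family `x_s` of coordinates of `x` over `k`, every other coordinate `x_j` is a simple
root of a polynomial `q_j` over `k[X_s]` (`exists_algebraicIndepOn_and_simple_root`). By the
implicit function theorem, the equations `q_j(X_s, X_j) = 0` cut out, near `x`, the graph of an
analytic map `H` defined on a connected neighbourhood `W` of `x_s`
(`exists_analytic_parametrization`). The set `D(F, x)` is the Zariski closure `E` of this graph.

* The coordinates of `H` are algebraic functions over `k[X_s]`, and `x_s` is a generic point. A
  polynomial over `k` vanishing at `x` therefore vanishes on the graph
  (`IsAnalyticGraph.aeval_eq_zero`).
* By quantifier elimination, membership in an `F`-semialgebraic set depends only on the signs of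
  finitely many polynomials over `k` (`IsSemialgebraicOver.signDetermined`). On the graph near `x`
  these signs are those at `x`: a polynomial vanishing at `x` vanishes on the graph, and otherwise
  the sign is locally constant. So an `F`-semialgebraic set through `x` contains the graph near `x`
  (`IsAnalyticGraph.eventually_mem`), and if it is algebraic it contains `E` by the identity
  theorem. Conversely `E` is the Zariski closure of an `F`-semialgebraic piece of the graph, and
  Zariski closures of definable sets are definable over the same parameters, as vanishing ideals are
  generated in bounded degree (`IsSemialgebraicOver.zeroLocus_vanishingIdeal`).
* Analytic functions on a connected open set form a domain, so the ideal of `E` is prime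
  (`IsAnalyticGraph.isPrime_vanishingIdeal`), which makes `E` irreducible.
* The dimension of `E` is the cardinality of `s`, because the parameters are a transcendence basis
  of the coordinate ring (`IsAnalyticGraph.ringKrullDim_quotient`). The tangent space at `x` has the
  same dimension: it contains the tangent space of the graph, and the gradients of the equations,
  independent because the roots are simple, bound it from above
  (`IsAnalyticGraph.finrank_zariskiTangentSpace`).
* If `E = {x}`, then `W` is a point, so `s` is empty and `x` is algebraic over `k`. A real closed
  subfield of `ℝ` is algebraically closed in `ℝ` (`mem_of_isAlgebraic_of_isRealClosed`).

Quantifier elimination follows Hörmander: by induction on degrees, the sign pattern along the real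
line of a finite family of polynomials in one variable is determined, up to an order automorphism of
the line, by the signs of finitely many polynomials in the coefficients (`exists_decides`).
-/

namespace RealAlg

/-! ### Order automorphisms of the line matching signs of functions -/

/-- Given `u, v` strictly between `α` and `β`, some order automorphism of `ℝ` moves `u` to `v` and
is the identity outside `(α, β)`: it is piecewise linear. -/
theorem exists_orderIso_move {α β u v : ℝ} (hu : u ∈ Set.Ioo α β) (hv : v ∈ Set.Ioo α β) :
    ∃ θ : ℝ ≃o ℝ, θ u = v ∧ (∀ t, t ≤ α → θ t = t) ∧ ∀ t, β ≤ t → θ t = t := by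
  obtain ⟨hu1, hu2⟩ := hu
  obtain ⟨hv1, hv2⟩ := hv
  set c := (v - α) / (u - α) with hc
  set e := (β - v) / (β - u) with he
  have hc0 : 0 < c := div_pos (by linarith) (by linarith)
  have he0 : 0 < e := div_pos (by linarith) (by linarith)
  have hcu : c * (u - α) = v - α := div_mul_cancel₀ _ (by linarith)
  have heu : e * (β - u) = β - v := div_mul_cancel₀ _ (by linarith)
  let f : ℝ → ℝ := fun t =>
    if t ≤ α then t else if t ≤ u then α + c * (t - α) else if t ≤ β then β - e * (β - t) else t
  have hf : StrictMono f := by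
    intro a b hab
    simp only [f]
    split_ifs <;> nlinarith
  have hs : Function.Surjective f := by
    intro y
    by_cases h1 : y ≤ α
    · exact ⟨y, by simp [f, h1]⟩
    by_cases h2 : y ≤ v
    · have hx : 0 < (y - α) / c := div_pos (by linarith) hc0
      have hx' : c * ((y - α) / c) = y - α := mul_div_cancel₀ _ hc0.ne'
      refine ⟨α + (y - α) / c, ?_⟩
      have h3 : (y - α) / c ≤ u - α := by
        rw [div_le_iff₀ hc0]; nlinarith
      simp only [f]
      rw [if_neg (by linarith), if_pos (by linarith)]
      linarith
    by_cases h3 : y ≤ β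
    · have hx : 0 ≤ (β - y) / e := div_nonneg (by linarith) he0.le
      have hx' : e * ((β - y) / e) = β - y := mul_div_cancel₀ _ he0.ne'
      refine ⟨β - (β - y) / e, ?_⟩
      have h4 : (β - y) / e < β - u := by
        rw [div_lt_iff₀ he0]; nlinarith
      simp only [f]
      rw [if_neg (by linarith), if_neg (by linarith), if_pos (by linarith)]
      linarith
    · refine ⟨y, ?_⟩
      simp only [f]
      rw [if_neg h1, if_neg (by linarith), if_neg h3]
  refine ⟨StrictMono.orderIsoOfSurjective f hf hs, ?_, ?_, ?_⟩
  · change f u = v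
    simp only [f]
    rw [if_neg (by linarith), if_pos le_rfl]
    linarith
  · intro t ht
    change f t = t
    simp [f, ht]
  · intro t ht
    change f t = t
    simp only [f]
    rcases ht.eq_or_lt with rfl | ht
    · rw [if_neg (by linarith), if_neg (by linarith), if_pos le_rfl]; ring
    · rw [if_neg (by linarith), if_neg (by linarith), if_neg (by linarith)]

/-- Two continuous strictly increasing functions with the same signs at the end points of an
interval have the same sign pattern there, up to an order automorphism supported inside. -/
theorem exists_orderIso_sign_eq_of_strictMonoOn {f g : ℝ → ℝ} {α β : ℝ} (hab : α < β)
    (hfc : Continuous f) (hgc : Continuous g)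
    (hf : StrictMonoOn f (Set.Icc α β)) (hg : StrictMonoOn g (Set.Icc α β))
    (h1 : SignType.sign (f α) = SignType.sign (g α))
    (h2 : SignType.sign (f β) = SignType.sign (g β)) :
    ∃ θ : ℝ ≃o ℝ, (∀ t, t ≤ α → θ t = t) ∧ (∀ t, β ≤ t → θ t = t) ∧
      ∀ t ∈ Set.Icc α β, SignType.sign (f t) = SignType.sign (g (θ t)) := by
  have hα : α ∈ Set.Icc α β := ⟨le_rfl, hab.le⟩
  have hβ : β ∈ Set.Icc α β := ⟨hab.le, le_rfl⟩
  by_cases hneg : f α < 0 ∧ 0 < f β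
  · obtain ⟨hn, hp⟩ := hneg
    have hn' : g α < 0 := by
      rw [← sign_eq_neg_one_iff, ← h1, sign_eq_neg_one_iff]; exact hn
    have hp' : 0 < g β := by
      rw [← sign_eq_one_iff, ← h2, sign_eq_one_iff]; exact hp
    obtain ⟨w, hw, hw0⟩ := intermediate_value_Ioo hab.le hfc.continuousOn ⟨hn, hp⟩
    obtain ⟨w', hw', hw0'⟩ := intermediate_value_Ioo hab.le hgc.continuousOn ⟨hn', hp'⟩
    obtain ⟨θ, hθ, hθ1, hθ2⟩ := exists_orderIso_move hw hw'
    refine ⟨θ, hθ1, hθ2, fun t ht => ?_⟩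
    have hwI := Set.Ioo_subset_Icc_self hw
    have hwI' := Set.Ioo_subset_Icc_self hw'
    have ht' : θ t ∈ Set.Icc α β := by
      constructor
      · rw [← hθ1 α le_rfl]; exact θ.monotone ht.1
      · rw [← hθ2 β le_rfl]; exact θ.monotone ht.2
    rcases lt_trichotomy t w with h | h | h
    · have h3 : θ t < w' := hθ ▸ θ.strictMono h
      rw [sign_neg (hw0 ▸ hf ht hwI h), sign_neg (hw0' ▸ hg ht' hwI' h3)]
    · rw [h, hθ, hw0, hw0']
    · have h3 : w' < θ t := hθ ▸ θ.strictMono h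
      rw [sign_pos (hw0 ▸ hf hwI ht h), sign_pos (hw0' ▸ hg hwI' ht' h3)]
  · refine ⟨OrderIso.refl ℝ, fun _ _ => rfl, fun _ _ => rfl, fun t ht => ?_⟩
    change SignType.sign (f t) = SignType.sign (g t)
    rcases ht.1.eq_or_lt with rfl | hαt
    · exact h1
    rcases ht.2.eq_or_lt with rfl | htβ
    · exact h2
    by_cases hn : f α < 0
    · have hp : f β ≤ 0 := not_lt.1 fun h => hneg ⟨hn, h⟩
      have hp' : g β ≤ 0 := by
        rw [← sign_nonpos_iff, ← h2, sign_nonpos_iff]; exact hp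
      rw [sign_neg ((hf ht hβ htβ).trans_le hp), sign_neg ((hg ht hβ htβ).trans_le hp')]
    · have hn : 0 ≤ f α := not_lt.1 hn
      have hn' : 0 ≤ g α := by
        rw [← sign_nonneg_iff, ← h1, sign_nonneg_iff]; exact hn
      rw [sign_pos (hn.trans_lt (hf hα ht hαt)), sign_pos (hn'.trans_lt (hg hα ht hαt))]

/-- The gluing lemma: if two continuous functions have the same signs at the points of a finite set
`N`, and between consecutive points of `N` both increase or both decrease, then up to an order
automorphism fixing `N` they have the same sign at every point between points of `N`. -/
theorem exists_orderIso_sign_eq_of_nodes {f g : ℝ → ℝ} (hfc : Continuous f) (hgc : Continuous g)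
    (N : Finset ℝ) (hN : ∀ t ∈ N, SignType.sign (f t) = SignType.sign (g t))
    (hmono : ∀ α ∈ N, ∀ β ∈ N, α < β → (∀ t ∈ N, ¬ (α < t ∧ t < β)) →
      (StrictMonoOn f (Set.Icc α β) ∧ StrictMonoOn g (Set.Icc α β)) ∨
      (StrictAntiOn f (Set.Icc α β) ∧ StrictAntiOn g (Set.Icc α β))) :
    ∃ ψ : ℝ ≃o ℝ, (∀ t ∈ N, ψ t = t) ∧ (∀ t, (∀ n ∈ N, n ≤ t) → ψ t = t) ∧
      (∀ t, (∀ n ∈ N, t ≤ n) → ψ t = t) ∧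
      ∀ t, (∃ n ∈ N, n ≤ t) → (∃ n ∈ N, t ≤ n) → SignType.sign (f t) = SignType.sign (g (ψ t)) := by
  induction N using Finset.induction_on_max with
  | empty => exact ⟨OrderIso.refl ℝ, by simp⟩
  | insert m N hm ih =>
    obtain ⟨ψ, h1, h2, h3, h4⟩ := ih (fun t ht => hN t (Finset.mem_insert_of_mem ht))
      (fun α hα β hβ hαβ h => hmono α (Finset.mem_insert_of_mem hα) β (Finset.mem_insert_of_mem hβ)
        hαβ (by
          intro t ht
          rcases Finset.mem_insert.1 ht with rfl | ht
          · exact fun h' => lt_asymm h'.2 (hm β hβ)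
          · exact h t ht))
    rcases N.eq_empty_or_nonempty with rfl | hne
    · refine ⟨OrderIso.refl ℝ, by simp, fun _ _ => rfl, fun _ _ => rfl, fun t => ?_⟩
      simp only [insert_empty_eq, Finset.mem_singleton, exists_eq_left]
      intro ha hb
      obtain rfl := le_antisymm ha hb
      exact hN _ (by simp)
    set M := N.max' hne with hM
    have hMN : M ∈ N := N.max'_mem hne
    have hle : ∀ n ∈ N, n ≤ M := fun n hn => N.le_max' n hn
    have hMm : M < m := hm M hMN
    have hmI : m ∈ insert m N := Finset.mem_insert_self _ _
    have hMI : M ∈ insert m N := Finset.mem_insert_of_mem hMN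
    obtain ⟨θ, ht1, ht2, ht3⟩ : ∃ θ : ℝ ≃o ℝ, (∀ t, t ≤ M → θ t = t) ∧ (∀ t, m ≤ t → θ t = t) ∧
        ∀ t ∈ Set.Icc M m, SignType.sign (f t) = SignType.sign (g (θ t)) := by
      rcases hmono M hMI m hmI hMm (by
        intro t ht h
        rcases Finset.mem_insert.1 ht with rfl | ht
        · exact lt_irrefl _ h.2
        · exact absurd (hle t ht) (not_le.2 h.1)) with ⟨ha, hb⟩ | ⟨ha, hb⟩
      · exact exists_orderIso_sign_eq_of_strictMonoOn hMm hfc hgc ha hb (hN M hMI) (hN m hmI)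
      · obtain ⟨θ, h5, h6, h7⟩ := exists_orderIso_sign_eq_of_strictMonoOn hMm hfc.neg hgc.neg
          (fun x hx y hy hxy => neg_lt_neg (ha hx hy hxy))
          (fun x hx y hy hxy => neg_lt_neg (hb hx hy hxy))
          (by simp only [Pi.neg_apply, Left.sign_neg, hN M hMI])
          (by simp only [Pi.neg_apply, Left.sign_neg, hN m hmI])
        refine ⟨θ, h5, h6, fun t ht => ?_⟩
        have := h7 t ht
        simpa only [Pi.neg_apply, Left.sign_neg, neg_inj] using this
    have hψM : ∀ t, M ≤ t → ψ t = t := fun t ht => h2 t fun n hn => (hle n hn).trans ht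
    have hψle : ∀ t, t ≤ M → ψ t ≤ M := fun t ht => by
      rw [← h1 M hMN]; exact ψ.monotone ht
    refine ⟨ψ.trans θ, fun t ht => ?_, fun t ht => ?_, fun t ht => ?_, fun t hx hy => ?_⟩
    · change θ (ψ t) = t
      rcases Finset.mem_insert.1 ht with rfl | ht
      · rw [hψM _ hMm.le, ht2 _ le_rfl]
      · rw [h1 t ht, ht1 t (hle t ht)]
    · change θ (ψ t) = t
      rw [hψM t (ht M hMI), ht2 t (ht m hmI)]
    · change θ (ψ t) = t
      rw [h3 t fun n hn => ht n (Finset.mem_insert_of_mem hn), ht1 t (ht M hMI)]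
    · change SignType.sign (f t) = SignType.sign (g (θ (ψ t)))
      rcases le_total t M with h | h
      · rw [ht1 _ (hψle t h)]
        refine h4 t ?_ ⟨M, hMN, h⟩
        obtain ⟨n, hn, hnt⟩ := hx
        rcases Finset.mem_insert.1 hn with rfl | hn
        · exact absurd (hMm.trans_le hnt) (not_lt.2 h)
        · exact ⟨n, hn, hnt⟩
      · rw [hψM t h]
        obtain ⟨n, hn, hnt⟩ := hy
        refine ht3 t ⟨h, ?_⟩
        rcases Finset.mem_insert.1 hn with rfl | hn
        · exact hnt
        · exact hnt.trans ((hle n hn).trans hMm.le)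

/-! ### Elimination of one real variable -/

open Polynomial in
/-- Pseudo-division with an even power of the leading coefficient, so that the multiplier does not
change signs. -/
theorem exists_even_pseudo_division {A : Type*} [CommRing A] (p q : A[X]) {j : ℕ} (hj : 0 < j)
    (hq : q.natDegree ≤ j) :
    ∃ (k : ℕ) (h r : A[X]), C (q.coeff j) ^ (2 * k) * p = q * h + r ∧ r.natDegree < j := by
  suffices H : ∀ n (p : A[X]), p.natDegree ≤ n →
      ∃ (k : ℕ) (h r : A[X]), C (q.coeff j) ^ k * p = q * h + r ∧ r.natDegree < j by
    obtain ⟨k, h, r, e, hr⟩ := H _ p le_rfl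
    refine ⟨k, C (q.coeff j) ^ k * h, C (q.coeff j) ^ k * r, ?_, ?_⟩
    · linear_combination C (q.coeff j) ^ k * e
    · rw [← C_pow]
      exact (natDegree_C_mul_le _ _).trans_lt hr
  intro n
  induction n with
  | zero => exact fun p hp => ⟨0, 0, p, by simp, by omega⟩
  | succ n ih =>
    intro p hp
    by_cases hpj : p.natDegree < j
    · exact ⟨0, 0, p, by simp, hpj⟩
    set p1 := C (q.coeff j) * p - C (p.coeff (n + 1)) * X ^ (n + 1 - j) * q with hp1
    have hjn : j ≤ n + 1 := by omega
    have hdeg : p1.natDegree ≤ n := by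
      rw [natDegree_le_iff_coeff_eq_zero]
      intro N hN
      rw [hp1, coeff_sub, coeff_C_mul, mul_assoc, coeff_C_mul, coeff_X_pow_mul']
      rw [if_pos (by omega)]
      rcases (Nat.succ_le_of_lt hN).eq_or_lt with h | h
      · subst h
        rw [show n.succ - (n + 1 - j) = j by omega]
        ring
      · rw [coeff_eq_zero_of_natDegree_lt (by omega : p.natDegree < N),
          coeff_eq_zero_of_natDegree_lt (by omega : q.natDegree < N - (n + 1 - j))]
        ring
    obtain ⟨k, h, r, e, hr⟩ := ih p1 hdeg
    refine ⟨k + 1, h + C (q.coeff j) ^ k * (C (p.coeff (n + 1)) * X ^ (n + 1 - j)), r, ?_, hr⟩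
    rw [hp1] at e
    linear_combination e

/-- The sum of the terms of degree at most `j` of a polynomial. -/
noncomputable def lowTerms {A : Type*} [CommRing A] (q : Polynomial A) (j : ℕ) : Polynomial A :=
  ∑ i ∈ Finset.range (j + 1), Polynomial.monomial i (q.coeff i)

theorem coeff_lowTerms {A : Type*} [CommRing A] (q : Polynomial A) (j i : ℕ) :
    (lowTerms q j).coeff i = if i ≤ j then q.coeff i else 0 := by
  simp [lowTerms, Polynomial.coeff_monomial]

theorem natDegree_lowTerms_le {A : Type*} [CommRing A] (q : Polynomial A) (j : ℕ) :
    (lowTerms q j).natDegree ≤ j := by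
  rw [Polynomial.natDegree_le_iff_coeff_eq_zero]
  intro N hN
  rw [coeff_lowTerms, if_neg (by omega)]

theorem sign_eq_of_ne_zero_on_uIcc {h : ℝ → ℝ} (hc : Continuous h) {s t : ℝ}
    (h0 : ∀ y ∈ Set.uIcc s t, h y ≠ 0) : SignType.sign (h s) = SignType.sign (h t) := by
  by_contra hne
  have : (0 : ℝ) ∈ Set.uIcc (h s) (h t) := by
    rcases lt_or_gt_of_ne (h0 s Set.left_mem_uIcc) with hs | hs <;>
    rcases lt_or_gt_of_ne (h0 t Set.right_mem_uIcc) with ht | ht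
    · simp [sign_neg hs, sign_neg ht] at hne
    · exact Set.mem_uIcc.2 (Or.inl ⟨hs.le, ht.le⟩)
    · exact Set.mem_uIcc.2 (Or.inr ⟨ht.le, hs.le⟩)
    · simp [sign_pos hs, sign_pos ht] at hne
  obtain ⟨y, hy, hy0⟩ := intermediate_value_uIcc hc.continuousOn this
  exact h0 y hy hy0

theorem exists_sign_eval_eq_leadingCoeff (f : Polynomial ℝ) (hf : 0 < f.natDegree) :
    ∃ T : ℝ, ∀ t, T ≤ t → SignType.sign (f.eval t) = SignType.sign f.leadingCoeff := by
  have hdeg : 0 < f.degree := Polynomial.natDegree_pos_iff_degree_pos.1 hf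
  have h0 : f.leadingCoeff ≠ 0 := by
    rw [Ne, Polynomial.leadingCoeff_eq_zero]; rintro rfl; simp at hf
  rcases lt_or_gt_of_ne h0 with h | h
  · have := (f.tendsto_atBot_of_leadingCoeff_nonpos hdeg h.le).eventually_lt_atBot 0
    obtain ⟨T, hT⟩ := Filter.eventually_atTop.1 this
    exact ⟨T, fun t ht => by rw [sign_neg (hT t ht), sign_neg h]⟩
  · have := (f.tendsto_atTop_of_leadingCoeff_nonneg hdeg h.le).eventually_gt_atTop 0
    obtain ⟨T, hT⟩ := Filter.eventually_atTop.1 this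
    exact ⟨T, fun t ht => by rw [sign_pos (hT t ht), sign_pos h]⟩

theorem exists_sign_eval_eq_neg_one_pow_mul_leadingCoeff (f : Polynomial ℝ)
    (hf : 0 < f.natDegree) :
    ∃ T : ℝ, ∀ t, t ≤ T →
      SignType.sign (f.eval t) = SignType.sign ((-1) ^ f.natDegree * f.leadingCoeff) := by
  obtain ⟨T, hT⟩ := exists_sign_eval_eq_leadingCoeff (f.comp (-Polynomial.X))
    (by simpa [Polynomial.natDegree_comp] using hf)
  refine ⟨-T, fun t ht => ?_⟩
  have := hT (-t) (by linarith)
  rw [Polynomial.leadingCoeff_comp (by simp)] at this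
  simpa [mul_comm] using this

open Polynomial in
/-- If an order automorphism matches the signs of a family containing the derivative of `p`, and
matches the signs of `p` at the zeros of the family, it can be modified to match the signs of `p`
everywhere: between consecutive zeros, `p` is monotone in both specializations. -/
theorem exists_orderIso_insert {A : Type*} [CommRing A] [DecidableEq A[X]]
    (R : Finset A[X]) (p : A[X]) (hder : derivative p ∈ R) (a b : A →+* ℝ) (φ : ℝ ≃o ℝ)
    (hφ : ∀ q ∈ R, ∀ t, SignType.sign ((q.map a).eval t) = SignType.sign ((q.map b).eval (φ t)))
    (hnode : ∀ q ∈ R, q.map a ≠ 0 → ∀ t, (q.map a).eval t = 0 →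
      SignType.sign ((p.map a).eval t) = SignType.sign ((p.map b).eval (φ t)))
    (hd : 0 < (p.map a).natDegree) (hdb : (p.map b).natDegree = (p.map a).natDegree)
    (hlc : SignType.sign (p.map a).leadingCoeff = SignType.sign (p.map b).leadingCoeff) :
    ∃ ψ : ℝ ≃o ℝ, ∀ q ∈ insert p R, ∀ t,
      SignType.sign ((q.map a).eval t) = SignType.sign ((q.map b).eval (ψ t)) := by
  classical
  set f := p.map a with hf
  set g := p.map b with hg
  obtain ⟨T1, hT1⟩ : ∃ T : ℝ, ∀ t, T ≤ t →
      SignType.sign (f.eval t) = SignType.sign (g.eval (φ t)) := by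
    obtain ⟨T, hT⟩ := exists_sign_eval_eq_leadingCoeff f hd
    obtain ⟨T', hT'⟩ := exists_sign_eval_eq_leadingCoeff g (hdb ▸ hd)
    refine ⟨max T (φ.symm T'), fun t ht => ?_⟩
    rw [hT t (le_of_max_le_left ht), hT' (φ t) ((φ.symm_apply_le).1 (le_of_max_le_right ht)), hlc]
  obtain ⟨T0, hT0⟩ : ∃ T : ℝ, ∀ t, t ≤ T →
      SignType.sign (f.eval t) = SignType.sign (g.eval (φ t)) := by
    obtain ⟨T, hT⟩ := exists_sign_eval_eq_neg_one_pow_mul_leadingCoeff f hd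
    obtain ⟨T', hT'⟩ := exists_sign_eval_eq_neg_one_pow_mul_leadingCoeff g (hdb ▸ hd)
    refine ⟨min T (φ.symm T'), fun t ht => ?_⟩
    rw [hT t (le_min_iff.1 ht).1, hT' (φ t) ((φ.le_symm_apply).1 (le_min_iff.1 ht).2), hdb,
      sign_mul, sign_mul, hlc]
  -- The nodes are the zeros of the family, together with one point beyond which the sign of `p`
  -- is that of its leading term, on either side.
  set N : Finset ℝ := insert T0 (insert T1 (R.biUnion fun q => (q.map a).roots.toFinset)) with hN
  have hroot : ∀ q ∈ R, q.map a ≠ 0 → ∀ t, (q.map a).eval t = 0 → t ∈ N := by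
    intro q hq h0 t ht
    simp only [hN, Finset.mem_insert, Finset.mem_biUnion, Multiset.mem_toFinset]
    exact Or.inr (Or.inr ⟨q, hq, (mem_roots h0).2 ht⟩)
  have hsign : ∀ t ∈ N, SignType.sign (f.eval t) = SignType.sign (g.eval (φ t)) := by
    intro t ht
    simp only [hN, Finset.mem_insert, Finset.mem_biUnion, Multiset.mem_toFinset] at ht
    rcases ht with rfl | rfl | ⟨q, hq, ht⟩
    · exact hT0 _ le_rfl
    · exact hT1 _ le_rfl
    · exact hnode q hq (ne_zero_of_mem_roots ht) t (isRoot_of_mem_roots ht)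
  have hder0 : (derivative p).map a ≠ 0 := by
    rw [← derivative_map]
    intro h
    exact hd.ne' (derivative_eq_zero.1 h)
  have hderf : ∀ t, deriv (fun t => f.eval t) t = ((derivative p).map a).eval t := by
    intro t; rw [Polynomial.deriv, derivative_map]
  have hderg : ∀ t, deriv (fun t => g.eval t) t = ((derivative p).map b).eval t := by
    intro t; rw [Polynomial.deriv, derivative_map]
  obtain ⟨ψ, h1, h2, h3, h4⟩ := exists_orderIso_sign_eq_of_nodes (f := fun t => f.eval t)
    (g := fun t => g.eval (φ t)) f.continuous (g.continuous.comp φ.continuous) N hsign (by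
      intro α hα β hβ hαβ hno
      have hne : ∀ t ∈ Set.Ioo α β, ((derivative p).map a).eval t ≠ 0 :=
        fun t ht h0 => hno t (hroot _ hder hder0 t h0) ht
      set m := (α + β) / 2
      have hm : m ∈ Set.Ioo α β := ⟨by simp only [m]; linarith, by simp only [m]; linarith⟩
      have hs : ∀ t ∈ Set.Ioo α β, SignType.sign (((derivative p).map a).eval t) =
          SignType.sign (((derivative p).map a).eval m) := fun t ht =>
        sign_eq_of_ne_zero_on_uIcc (h := fun t => ((derivative p).map a).eval t)
          (Polynomial.continuous _) fun y hy =>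
            hne y ((Set.ordConnected_Ioo (a := α) (b := β)).uIcc_subset ht hm hy)
      have hs' : ∀ y ∈ Set.Ioo (φ α) (φ β), SignType.sign (((derivative p).map b).eval y) =
          SignType.sign (((derivative p).map a).eval m) := by
        intro y hy
        rw [← hs (φ.symm y) ⟨(φ.lt_symm_apply).2 hy.1, (φ.symm_apply_lt).2 hy.2⟩, hφ _ hder,
          φ.apply_symm_apply]
      have hφI : ∀ t ∈ Set.Icc α β, φ t ∈ Set.Icc (φ α) (φ β) :=
        fun t ht => ⟨φ.monotone ht.1, φ.monotone ht.2⟩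
      rcases lt_or_gt_of_ne (hne m hm) with hlt | hgt
      · right
        constructor
        · refine strictAntiOn_of_deriv_neg (convex_Icc _ _) f.continuous.continuousOn ?_
          intro t ht
          rw [interior_Icc] at ht
          rw [hderf, ← sign_eq_neg_one_iff, hs t ht, sign_neg hlt]
        · have : StrictAntiOn (fun y => g.eval y) (Set.Icc (φ α) (φ β)) := by
            refine strictAntiOn_of_deriv_neg (convex_Icc _ _) g.continuous.continuousOn ?_
            intro t ht
            rw [interior_Icc] at ht
            rw [hderg, ← sign_eq_neg_one_iff, hs' t ht, sign_neg hlt]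
          exact fun x hx y hy hxy => this (hφI x hx) (hφI y hy) (φ.strictMono hxy)
      · left
        constructor
        · refine strictMonoOn_of_deriv_pos (convex_Icc _ _) f.continuous.continuousOn ?_
          intro t ht
          rw [interior_Icc] at ht
          rw [hderf, ← sign_eq_one_iff, hs t ht, sign_pos hgt]
        · have : StrictMonoOn (fun y => g.eval y) (Set.Icc (φ α) (φ β)) := by
            refine strictMonoOn_of_deriv_pos (convex_Icc _ _) g.continuous.continuousOn ?_
            intro t ht
            rw [interior_Icc] at ht
            rw [hderg, ← sign_eq_one_iff, hs' t ht, sign_pos hgt]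
          exact fun x hx y hy hxy => this (hφI x hx) (hφI y hy) (φ.strictMono hxy))
  refine ⟨ψ.trans φ, fun q hq t => ?_⟩
  change _ = SignType.sign ((q.map b).eval (φ (ψ t)))
  rcases Finset.mem_insert.1 hq with rfl | hq
  · by_cases hx : ∃ n ∈ N, n ≤ t
    · by_cases hy : ∃ n ∈ N, t ≤ n
      · exact h4 t hx hy
      · push Not at hy
        rw [h2 t fun n hn => (hy n hn).le]
        exact hT1 t (hy T1 (by simp [hN])).le
    · push Not at hx
      rw [h3 t fun n hn => (hx n hn).le]
      exact hT0 t (hx T0 (by simp [hN])).le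
  · rw [← hφ q hq]
    by_cases h0 : q.map a = 0
    · simp [h0]
    by_cases htN : t ∈ N
    · rw [h1 t htN]
    refine sign_eq_of_ne_zero_on_uIcc (h := fun t => (q.map a).eval t) (Polynomial.continuous _) ?_
    -- A zero between `t` and `ψ t` would be a node, and `ψ` fixes the nodes.
    intro y hy hy0
    have hyN := hroot q hq h0 y hy0
    have hψy := h1 y hyN
    rcases Set.mem_uIcc.1 hy with ⟨hy1, hy2⟩ | ⟨hy1, hy2⟩
    · have : ψ t ≤ ψ y := ψ.monotone hy1
      have : ψ t = ψ y := by rw [hψy] at this ⊢; exact le_antisymm this hy2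
      exact htN (ψ.injective this ▸ hyN)
    · have : ψ y ≤ ψ t := ψ.monotone hy2
      have : ψ t = ψ y := by rw [hψy] at this ⊢; exact le_antisymm hy1 this
      exact htN (ψ.injective this ▸ hyN)

open Polynomial in
/-- `Q` decides `P` if two specializations of the coefficient ring giving the same signs to the
elements of `Q` give the polynomials in `P` the same sign patterns along the line, up to an order
automorphism of the line. -/
def Decides {A : Type*} [CommRing A] (Q : Finset A) (P : Finset A[X]) : Prop :=
  ∀ a b : A →+* ℝ, (∀ q ∈ Q, SignType.sign (a q) = SignType.sign (b q)) →
    ∃ φ : ℝ ≃o ℝ, ∀ p ∈ P, ∀ t,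
      SignType.sign ((p.map a).eval t) = SignType.sign ((p.map b).eval (φ t))

open Polynomial in
/-- The inductive step of the elimination: a polynomial `p` of maximal degree is traded for its
derivative, its tail, and its pseudo-remainders by the truncations of the other polynomials. -/
theorem exists_decides_insert {A : Type*} [CommRing A] [DecidableEq A[X]] (P : Finset A[X])
    (p : A[X]) {d : ℕ} (hp : p.natDegree = d + 1) (hP : ∀ q ∈ P, q.natDegree ≤ d + 1)
    (ih : ∀ P' : Finset A[X], (∀ q ∈ P', q.natDegree ≤ d + 1) →
      (∀ q ∈ P', q.natDegree = d + 1 → q ∈ P) → ∃ Q, Decides Q P') :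
    ∃ Q, Decides Q (insert p P) := by
  classical
  set R := insert (derivative p) P with hR
  have hpd : (derivative p).natDegree ≤ d := (natDegree_derivative_le p).trans (by omega)
  have hRd : ∀ q ∈ R, q.natDegree ≤ d + 1 := by
    intro q hq
    rcases Finset.mem_insert.1 hq with rfl | hq
    · omega
    · exact hP q hq
  have hdiv : ∀ (q : A[X]) (j : ℕ), ∃ r : A[X], 0 < j →
      r.natDegree < j ∧ ∃ (k : ℕ) (h : A[X]),
        C (q.coeff j) ^ (2 * k) * p = lowTerms q j * h + r := by
    intro q j
    by_cases hj : 0 < j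
    · obtain ⟨k, h, r, e, hr⟩ :=
        exists_even_pseudo_division p (lowTerms q j) hj (natDegree_lowTerms_le q j)
      rw [coeff_lowTerms, if_pos le_rfl] at e
      exact ⟨r, fun _ => ⟨hr, k, h, e⟩⟩
    · exact ⟨0, fun h => absurd h hj⟩
  choose rem hrem using hdiv
  set S : Finset A[X] := R.biUnion fun q => (Finset.Icc 1 (d + 1)).image (rem q) with hS
  have hSd : ∀ q ∈ S, q.natDegree ≤ d := by
    intro q hq
    obtain ⟨q', -, hq⟩ := Finset.mem_biUnion.1 hq
    obtain ⟨j, hj, rfl⟩ := Finset.mem_image.1 hq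
    rw [Finset.mem_Icc] at hj
    have := (hrem q' j hj.1).1
    omega
  have hpe : p.eraseLead.natDegree ≤ d := by
    have := eraseLead_natDegree_le p
    omega
  obtain ⟨Q', hQ'⟩ := ih (insert p.eraseLead (R ∪ S)) (by
      intro q hq
      rcases Finset.mem_insert.1 hq with rfl | hq
      · omega
      rcases Finset.mem_union.1 hq with hq | hq
      · exact hRd q hq
      · exact (hSd q hq).trans (by omega)) (by
      intro q hq hqd
      rcases Finset.mem_insert.1 hq with rfl | hq
      · omega
      rcases Finset.mem_union.1 hq with hq | hq
      · rcases Finset.mem_insert.1 hq with rfl | hq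
        · omega
        · exact hq
      · have := hSd q hq
        omega)
  refine ⟨insert p.leadingCoeff (Q' ∪ R.biUnion fun q => (Finset.range (d + 2)).image q.coeff), ?_⟩
  intro a b hab
  obtain ⟨φ, hφ⟩ := hQ' a b fun q hq => hab q (by simp [hq])
  have hlc := hab p.leadingCoeff (by simp)
  have hcoeff : ∀ q ∈ R, ∀ i, SignType.sign (a (q.coeff i)) = SignType.sign (b (q.coeff i)) := by
    intro q hq i
    by_cases hi : i < d + 2
    · refine hab _ (Finset.mem_insert_of_mem (Finset.mem_union_right _ ?_))
      exact Finset.mem_biUnion.2 ⟨q, hq, Finset.mem_image.2 ⟨i, Finset.mem_range.2 hi, rfl⟩⟩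
    · rw [coeff_eq_zero_of_natDegree_lt (by have := hRd q hq; omega)]
      simp
  by_cases ha0 : a p.leadingCoeff = 0
  · have hb0 : b p.leadingCoeff = 0 := by
      rw [ha0, sign_zero] at hlc
      exact sign_eq_zero_iff.1 hlc.symm
    refine ⟨φ, fun q hq t => ?_⟩
    rcases Finset.mem_insert.1 hq with rfl | hq
    · have key : ∀ c : A →+* ℝ, c q.leadingCoeff = 0 → q.map c = q.eraseLead.map c := by
        intro c hc
        conv_lhs => rw [← eraseLead_add_C_mul_X_pow q]
        rw [Polynomial.map_add, Polynomial.map_mul, map_C, hc, C_0, zero_mul, add_zero]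
      rw [key a ha0, key b hb0]
      exact hφ _ (Finset.mem_insert_self _ _) t
    · exact hφ q (by simp [hR, hq]) t
  -- At a zero of `q`, whose specialization has degree `j`, the sign of `p` is that of its
  -- pseudo-remainder by the terms of `q` of degree at most `j`.
  · have hb0 : b p.leadingCoeff ≠ 0 := by
      intro hb0
      rw [hb0, sign_zero] at hlc
      exact ha0 (sign_eq_zero_iff.1 hlc)
    have hda := natDegree_map_of_leadingCoeff_ne_zero a ha0
    have hdb := natDegree_map_of_leadingCoeff_ne_zero b hb0
    obtain ⟨ψ, hψ⟩ := exists_orderIso_insert R p (Finset.mem_insert_self _ _) a b φ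
      (fun q hq t => hφ q (by simp [hq]) t) (by
        intro q hq h0 t ht
        set j := (q.map a).natDegree with hj
        have hj0 : 0 < j := by
          rw [hj, Nat.pos_iff_ne_zero]
          intro hz
          rw [eq_C_of_natDegree_eq_zero hz] at ht h0
          rw [eval_C] at ht
          exact h0 (by rw [ht, C_0])
        have hjd : j ≤ d + 1 := natDegree_map_le.trans (hRd q hq)
        obtain ⟨-, k, h, e⟩ := hrem q j hj0
        have hr : rem q j ∈ insert p.eraseLead (R ∪ S) := by
          refine Finset.mem_insert_of_mem (Finset.mem_union_right _ ?_)
          exact Finset.mem_biUnion.2 ⟨q, hq, Finset.mem_image.2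
            ⟨j, Finset.mem_Icc.2 ⟨hj0, hjd⟩, rfl⟩⟩
        have hca : a (q.coeff j) ≠ 0 := by
          rw [← coeff_map]
          exact leadingCoeff_ne_zero.2 h0
        have hzero : ∀ i, a (q.coeff i) = 0 → b (q.coeff i) = 0 := by
          intro i hi
          have := hcoeff q hq i
          rw [hi, sign_zero] at this
          exact sign_eq_zero_iff.1 this.symm
        have hcb : b (q.coeff j) ≠ 0 := by
          intro hb
          have := hcoeff q hq j
          rw [hb, sign_zero] at this
          exact hca (sign_eq_zero_iff.1 this)
        have hlow : ∀ i, j < i → a (q.coeff i) = 0 := by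
          intro i hi
          rw [← coeff_map]
          exact coeff_eq_zero_of_natDegree_lt hi
        have hla : (lowTerms q j).map a = q.map a := by
          ext i
          rw [coeff_map, coeff_map, coeff_lowTerms]
          split_ifs with hi
          · rfl
          · rw [hlow i (by omega), map_zero]
        have hlb : (lowTerms q j).map b = q.map b := by
          ext i
          rw [coeff_map, coeff_map, coeff_lowTerms]
          split_ifs with hi
          · rfl
          · rw [hzero i (hlow i (by omega)), map_zero]
        have ht' : (q.map b).eval (φ t) = 0 := by
          have := hφ q (by simp [hq]) t
          rw [ht, sign_zero] at this
          exact sign_eq_zero_iff.1 this.symm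
        have hsgn : ∀ (c : A →+* ℝ) (u : ℝ), c (q.coeff j) ≠ 0 →
            ((lowTerms q j).map c).eval u = 0 →
            SignType.sign ((p.map c).eval u) = SignType.sign (((rem q j).map c).eval u) := by
          intro c u hc hu
          have := congrArg (fun P => (P.map c).eval u) e
          simp only [Polynomial.map_mul, Polynomial.map_add, Polynomial.map_pow, map_C, eval_mul,
            eval_add, eval_pow, eval_C, hu, zero_mul, zero_add] at this
          have hpos : 0 < c (q.coeff j) ^ (2 * k) := by rw [pow_mul]; positivity
          rw [← this, sign_mul, sign_pos hpos, one_mul]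
        rw [hsgn a t hca (by rw [hla, ht]), hsgn b (φ t) hcb (by rw [hlb, ht'])]
        exact hφ _ hr t)
      (by omega) (by omega) (by
        rw [leadingCoeff_map_of_leadingCoeff_ne_zero a ha0,
          leadingCoeff_map_of_leadingCoeff_ne_zero b hb0, hlc])
    refine ⟨ψ, fun q hq t => hψ q ?_ t⟩
    rcases Finset.mem_insert.1 hq with rfl | hq
    · exact Finset.mem_insert_self _ _
    · simp [hR, hq]

open Polynomial in
/-- Elimination of one variable (Hörmander): every finite family of polynomials is decided by a
finite set of elements of the coefficient ring. -/
theorem exists_decides {A : Type*} [CommRing A] (P : Finset A[X]) : ∃ Q, Decides Q P := by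
  classical
  suffices H : ∀ d : ℕ, ∀ P : Finset A[X], (∀ p ∈ P, p.natDegree ≤ d) → ∃ Q, Decides Q P from
    H (P.sup natDegree) P fun p hp => Finset.le_sup hp
  intro d
  induction d with
  | zero =>
    refine fun P hP => ⟨P.image fun p => p.coeff 0, fun a b hab => ⟨OrderIso.refl ℝ, ?_⟩⟩
    intro p hp t
    rw [eq_C_of_natDegree_eq_zero (Nat.le_zero.1 (hP p hp))]
    simpa using hab _ (Finset.mem_image_of_mem _ hp)
  | succ d ihd =>
    suffices H : ∀ n : ℕ, ∀ P : Finset A[X], (∀ p ∈ P, p.natDegree ≤ d + 1) →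
        (P.filter fun p => p.natDegree = d + 1).card ≤ n → ∃ Q, Decides Q P from
      fun P hP => H _ P hP le_rfl
    intro n
    induction n with
    | zero =>
      intro P hP hn
      refine ihd P fun p hp => ?_
      have h1 := hP p hp
      have h2 : p.natDegree ≠ d + 1 := fun h => by
        have hmem : p ∈ P.filter fun p => p.natDegree = d + 1 := by simp [hp, h]
        have := Finset.card_pos.2 ⟨p, hmem⟩
        omega
      omega
    | succ n ihn =>
      -- Induction on the number of members of maximal degree.
      intro P hP hn
      by_cases hne : (P.filter fun p => p.natDegree = d + 1).Nonempty
      · obtain ⟨p, hp⟩ := hne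
        have hpP := (Finset.mem_filter.1 hp).1
        rw [← Finset.insert_erase hpP]
        refine exists_decides_insert (P.erase p) p (Finset.mem_filter.1 hp).2
          (fun q hq => hP q (Finset.mem_of_mem_erase hq)) fun P' h1 h2 => ihn P' h1 ?_
        have hsub : (P'.filter fun q => q.natDegree = d + 1) ⊆
            (P.filter fun q => q.natDegree = d + 1).erase p := by
          intro q hq
          obtain ⟨hq1, hq2⟩ := Finset.mem_filter.1 hq
          have := Finset.mem_erase.1 (h2 q hq1 hq2)
          exact Finset.mem_erase.2 ⟨this.1, Finset.mem_filter.2 ⟨this.2, hq2⟩⟩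
        have := Finset.card_le_card hsub
        rw [Finset.card_erase_of_mem hp] at this
        omega
      · rw [Finset.not_nonempty_iff_eq_empty] at hne
        exact ihn P hP (by simp [hne])

/-! ### Quantifier elimination -/

/-- A set is sign-determined over a subring `k` if membership of a point depends only on the signs
at the point of finitely many polynomials over `k`. These are the sets defined by quantifier-free
formulas with parameters in `k`. -/
def SignDetermined (k : Subring ℝ) {ι : Type*} (S : Set (ι → ℝ)) : Prop :=
  ∃ Q : Finset (MvPolynomial ι k), ∀ a b : ι → ℝ,
    (∀ q ∈ Q, SignType.sign (MvPolynomial.aeval a q) = SignType.sign (MvPolynomial.aeval b q)) →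
      a ∈ S → b ∈ S

theorem SignDetermined.imp {k : Subring ℝ} {ι : Type*} {S T : Set (ι → ℝ)}
    (hS : SignDetermined k S) (hT : SignDetermined k T) :
    SignDetermined k {a | a ∈ S → a ∈ T} := by
  classical
  obtain ⟨Q, hQ⟩ := hS
  obtain ⟨Q', hQ'⟩ := hT
  refine ⟨Q ∪ Q', fun a b hab h hb => ?_⟩
  exact hQ' a b (fun q hq => hab q (Finset.mem_union_right _ hq))
    (h (hQ b a (fun q hq => (hab q (Finset.mem_union_left _ hq)).symm) hb))

/-- Universal quantification over one coordinate. The coordinates indexed by `κ` are those indexed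
by `ι` and the quantified one, as told by `e`. -/
theorem SignDetermined.forall {k : Subring ℝ} {ι κ : Type*} {S : Set (κ → ℝ)}
    (hS : SignDetermined k S) (e : κ → Option ι) :
    SignDetermined k {w : ι → ℝ | ∀ t : ℝ, (fun j => (e j).elim t w) ∈ S} := by
  classical
  obtain ⟨Q, hQ⟩ := hS
  let θ : MvPolynomial κ k →+* Polynomial (MvPolynomial ι k) :=
    MvPolynomial.eval₂Hom (Polynomial.C.comp MvPolynomial.C)
      fun j => (e j).elim Polynomial.X fun i => Polynomial.C (MvPolynomial.X i)
  let ev : (ι → ℝ) → MvPolynomial ι k →+* ℝ := fun w => (MvPolynomial.aeval w).toRingHom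
  have hθ : ∀ (w : ι → ℝ) (t : ℝ) (q : MvPolynomial κ k),
      ((θ q).map (ev w)).eval t = MvPolynomial.aeval (fun j => (e j).elim t w) q := by
    intro w t q
    have : ((Polynomial.evalRingHom t).comp (Polynomial.mapRingHom (ev w))).comp θ =
        (MvPolynomial.aeval (R := k) fun j => (e j).elim t w).toRingHom := by
      refine MvPolynomial.ringHom_ext (fun r => ?_) fun j => ?_
      · simp [θ, ev]
      · cases h : e j <;> simp [θ, ev, h]
    exact congrArg (fun f => f q) this
  obtain ⟨Q', hQ'⟩ := exists_decides (Q.image θ)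
  refine ⟨Q', fun a b hab ha t => ?_⟩
  obtain ⟨φ, hφ⟩ := hQ' (ev a) (ev b) hab
  refine hQ _ _ (fun q hq => ?_) (ha (φ.symm t))
  have := hφ (θ q) (Finset.mem_image_of_mem _ hq) (φ.symm t)
  rwa [hθ, hθ, φ.apply_symm_apply] at this

theorem realize_add_symb {F : Set ℝ} {ι : Type*} (ts : Fin 2 → (rcfLang[[F]]).Term ι)
    (v : ι → ℝ) :
    (Language.Term.func (L := rcfLang[[F]]) (Sum.inl (Sum.inl ringFunc.add)) ts).realize v =
      (ts 0).realize v + (ts 1).realize v :=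
  Ring.CompatibleRing.funMap_add (R := ℝ) fun i => (ts i).realize v

theorem realize_mul_symb {F : Set ℝ} {ι : Type*} (ts : Fin 2 → (rcfLang[[F]]).Term ι)
    (v : ι → ℝ) :
    (Language.Term.func (L := rcfLang[[F]]) (Sum.inl (Sum.inl ringFunc.mul)) ts).realize v =
      (ts 0).realize v * (ts 1).realize v :=
  Ring.CompatibleRing.funMap_mul (R := ℝ) fun i => (ts i).realize v

theorem realize_neg_symb {F : Set ℝ} {ι : Type*} (ts : Fin 1 → (rcfLang[[F]]).Term ι)
    (v : ι → ℝ) :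
    (Language.Term.func (L := rcfLang[[F]]) (Sum.inl (Sum.inl ringFunc.neg)) ts).realize v =
      -(ts 0).realize v :=
  Ring.CompatibleRing.funMap_neg (R := ℝ) fun i => (ts i).realize v

theorem realize_zero_symb {F : Set ℝ} {ι : Type*} (ts : Fin 0 → (rcfLang[[F]]).Term ι)
    (v : ι → ℝ) :
    (Language.Term.func (L := rcfLang[[F]]) (Sum.inl (Sum.inl ringFunc.zero)) ts).realize v = 0 :=
  Ring.CompatibleRing.funMap_zero (R := ℝ) fun i => (ts i).realize v

theorem realize_one_symb {F : Set ℝ} {ι : Type*} (ts : Fin 0 → (rcfLang[[F]]).Term ι)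
    (v : ι → ℝ) :
    (Language.Term.func (L := rcfLang[[F]]) (Sum.inl (Sum.inl ringFunc.one)) ts).realize v = 1 :=
  Ring.CompatibleRing.funMap_one (R := ℝ) fun i => (ts i).realize v

theorem exists_aeval_eq_realize (F : Set ℝ) {ι : Type*} (t : (rcfLang[[F]]).Term ι) :
    ∃ p : MvPolynomial ι (Subring.closure F), ∀ v : ι → ℝ,
      t.realize v = MvPolynomial.aeval v p := by
  induction t with
  | var i => exact ⟨MvPolynomial.X i, fun v => by simp⟩
  | func f ts ih =>
    choose p hp using ih
    rcases f with (f | f) | f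
    · cases f with
      | add =>
        refine ⟨p 0 + p 1, fun v => ?_⟩
        rw [map_add, ← hp, ← hp]
        exact realize_add_symb ts v
      | mul =>
        refine ⟨p 0 * p 1, fun v => ?_⟩
        rw [map_mul, ← hp, ← hp]
        exact realize_mul_symb ts v
      | neg =>
        refine ⟨-p 0, fun v => ?_⟩
        rw [map_neg, ← hp]
        exact realize_neg_symb ts v
      | zero =>
        refine ⟨0, fun v => ?_⟩
        rw [map_zero]
        exact realize_zero_symb ts v
      | one =>
        refine ⟨1, fun v => ?_⟩
        rw [map_one]
        exact realize_one_symb ts v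
    · exact isEmptyElim f
    · rename_i n
      cases n with
      | zero =>
        let c : F := f
        refine ⟨MvPolynomial.C ⟨c, Subring.subset_closure c.2⟩, fun v => ?_⟩
        rw [MvPolynomial.aeval_C]
        rfl
      | succ n => exact f.elim

/-- Tarski's theorem: a set defined by a formula with parameters in `F` is sign-determined over the
ring generated by `F`. -/
theorem signDetermined_realize (F : Set ℝ) {α : Type*} {n : ℕ}
    (φ : (rcfLang[[F]]).BoundedFormula α n) :
    SignDetermined (Subring.closure F)
      {w : α ⊕ Fin n → ℝ | φ.Realize (w ∘ Sum.inl) (w ∘ Sum.inr)} := by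
  classical
  induction φ with
  | falsum => exact ⟨∅, fun a b _ h => h⟩
  | equal t₁ t₂ =>
    obtain ⟨p, hp⟩ := exists_aeval_eq_realize F t₁
    obtain ⟨q, hq⟩ := exists_aeval_eq_realize F t₂
    refine ⟨{p - q}, fun a b hab h => ?_⟩
    have hab := hab _ (Finset.mem_singleton_self _)
    change t₁.realize (Sum.elim (a ∘ Sum.inl) (a ∘ Sum.inr)) =
      t₂.realize (Sum.elim (a ∘ Sum.inl) (a ∘ Sum.inr)) at h
    change t₁.realize (Sum.elim (b ∘ Sum.inl) (b ∘ Sum.inr)) =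
      t₂.realize (Sum.elim (b ∘ Sum.inl) (b ∘ Sum.inr))
    rw [Sum.elim_comp_inl_inr, hp, hq] at h ⊢
    rw [map_sub (MvPolynomial.aeval (R := Subring.closure F) a), h, sub_self, sign_zero,
      map_sub (MvPolynomial.aeval (R := Subring.closure F) b)] at hab
    exact sub_eq_zero.1 (sign_eq_zero_iff.1 hab.symm)
  | rel R ts =>
    rcases R with (R | R) | R
    · exact isEmptyElim R
    · cases R
      obtain ⟨p, hp⟩ := exists_aeval_eq_realize F (ts 0)
      obtain ⟨q, hq⟩ := exists_aeval_eq_realize F (ts 1)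
      refine ⟨{q - p}, fun a b hab h => ?_⟩
      have hab := hab _ (Finset.mem_singleton_self _)
      change (ts 0).realize (Sum.elim (a ∘ Sum.inl) (a ∘ Sum.inr)) ≤
        (ts 1).realize (Sum.elim (a ∘ Sum.inl) (a ∘ Sum.inr)) at h
      change (ts 0).realize (Sum.elim (b ∘ Sum.inl) (b ∘ Sum.inr)) ≤
        (ts 1).realize (Sum.elim (b ∘ Sum.inl) (b ∘ Sum.inr))
      rw [Sum.elim_comp_inl_inr, hp, hq] at h ⊢
      rw [← sub_nonneg, ← sign_nonneg_iff, ← map_sub] at h ⊢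
      rwa [← hab]
    · exact isEmptyElim R
  | imp _ _ ih1 ih2 => exact ih1.imp ih2
  | @all n φ ih =>
    have := ih.forall (ι := α ⊕ Fin n)
      (Sum.elim (fun i => some (Sum.inl i)) (Fin.lastCases none fun i => some (Sum.inr i)))
    convert this using 3 with w
    change (∀ t : ℝ, φ.Realize (w ∘ Sum.inl) (Fin.snoc (w ∘ Sum.inr) t)) ↔ _
    refine forall_congr' fun t => ?_
    rw [Set.mem_ofPred_eq]
    refine iff_of_eq (congrArg₂ _ rfl ?_)
    funext i
    refine Fin.lastCases ?_ (fun i => ?_) i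
    · simp
    · simp

theorem IsSemialgebraicOver.signDetermined {d : ℕ} {F : Set ℝ} {A : Set (Fin d → ℝ)}
    (hA : IsSemialgebraicOver F A) : SignDetermined (Subring.closure F) A := by
  classical
  obtain ⟨φ, rfl⟩ := hA
  obtain ⟨Q, hQ⟩ := signDetermined_realize F φ
  have e : ∀ a : Fin d → ℝ, ∀ q : MvPolynomial (Fin d ⊕ Fin 0) (Subring.closure F),
      MvPolynomial.aeval (Sum.elim a default) q =
        MvPolynomial.aeval a (MvPolynomial.rename (Sum.elim id finZeroElim) q) := by
    intro a q
    rw [MvPolynomial.aeval_rename]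
    congr 2
    funext i
    rcases i with i | i
    · rfl
    · exact i.elim0
  refine ⟨Q.image (MvPolynomial.rename (Sum.elim id finZeroElim)), fun a b hab ha => ?_⟩
  let o : Fin 0 → ℝ := default
  have key : ∀ c : Fin d → ℝ, φ.Realize c ↔ Language.BoundedFormula.Realize φ
      (Sum.elim c o ∘ Sum.inl) (Sum.elim c o ∘ Sum.inr) := fun c =>
    iff_of_eq (congrArg (Language.BoundedFormula.Realize φ c)
      (Subsingleton.elim (α := Fin 0 → ℝ) _ _))
  refine (key b).2 (hQ (Sum.elim a o) (Sum.elim b o) (fun q hq => ?_) ((key a).1 ha))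
  rw [e, e]
  exact hab _ (Finset.mem_image_of_mem _ hq)

/-! ### Definable sets -/

/-- Elements of the ring generated by the parameters are named by closed terms. -/
theorem exists_term_realize_eq_const (F : Set ℝ) {ι : Type*} (c : ℝ)
    (hc : c ∈ Subring.closure F) :
    ∃ t : (rcfLang[[F]]).Term ι, ∀ v : ι → ℝ, t.realize v = c := by
  induction hc using Subring.closure_induction with
  | mem c hc => exact ⟨(rcfLang.con (⟨c, hc⟩ : F)).term, fun v => rfl⟩
  | zero =>
    exact ⟨Language.Term.func (L := rcfLang[[F]]) (Sum.inl (Sum.inl ringFunc.zero)) ![],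
      fun v => realize_zero_symb _ v⟩
  | one =>
    exact ⟨Language.Term.func (L := rcfLang[[F]]) (Sum.inl (Sum.inl ringFunc.one)) ![],
      fun v => realize_one_symb _ v⟩
  | add x y _ _ hx hy =>
    obtain ⟨t, ht⟩ := hx
    obtain ⟨u, hu⟩ := hy
    refine ⟨Language.Term.func (L := rcfLang[[F]]) (Sum.inl (Sum.inl ringFunc.add)) ![t, u],
      fun v => ?_⟩
    rw [← ht v, ← hu v]
    exact realize_add_symb _ v
  | neg x _ hx =>
    obtain ⟨t, ht⟩ := hx
    refine ⟨Language.Term.func (L := rcfLang[[F]]) (Sum.inl (Sum.inl ringFunc.neg)) ![t],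
      fun v => ?_⟩
    rw [← ht v]
    exact realize_neg_symb _ v
  | mul x y _ _ hx hy =>
    obtain ⟨t, ht⟩ := hx
    obtain ⟨u, hu⟩ := hy
    refine ⟨Language.Term.func (L := rcfLang[[F]]) (Sum.inl (Sum.inl ringFunc.mul)) ![t, u],
      fun v => ?_⟩
    rw [← ht v, ← hu v]
    exact realize_mul_symb _ v

theorem exists_term_realize_eq_aeval (F : Set ℝ) {ι : Type*}
    (p : MvPolynomial ι (Subring.closure F)) :
    ∃ t : (rcfLang[[F]]).Term ι, ∀ v : ι → ℝ, t.realize v = MvPolynomial.aeval v p := by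
  induction p using MvPolynomial.induction_on with
  | C c =>
    obtain ⟨t, ht⟩ := exists_term_realize_eq_const F (ι := ι) c c.2
    exact ⟨t, fun v => by rw [ht, MvPolynomial.aeval_C]; rfl⟩
  | add p q hp hq =>
    obtain ⟨t, ht⟩ := hp
    obtain ⟨u, hu⟩ := hq
    refine ⟨Language.Term.func (L := rcfLang[[F]]) (Sum.inl (Sum.inl ringFunc.add)) ![t, u],
      fun v => ?_⟩
    rw [map_add, ← ht v, ← hu v]
    exact realize_add_symb _ v
  | mul_X p i hp =>
    obtain ⟨t, ht⟩ := hp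
    refine ⟨Language.Term.func (L := rcfLang[[F]]) (Sum.inl (Sum.inl ringFunc.mul))
      ![t, Language.Term.var i], fun v => ?_⟩
    rw [map_mul, ← ht v, MvPolynomial.aeval_X]
    exact realize_mul_symb _ v

theorem definable_aeval_eq_zero (F : Set ℝ) {ι : Type*} (p : MvPolynomial ι (Subring.closure F)) :
    F.Definable rcfLang {v : ι → ℝ | MvPolynomial.aeval v p = 0} := by
  obtain ⟨t, ht⟩ := exists_term_realize_eq_aeval F p
  obtain ⟨u, hu⟩ := exists_term_realize_eq_aeval F (0 : MvPolynomial ι (Subring.closure F))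
  refine ⟨t.equal u, ?_⟩
  ext v
  simp [ht, hu]

theorem definable_aeval_nonneg (F : Set ℝ) {ι : Type*} (p : MvPolynomial ι (Subring.closure F)) :
    F.Definable rcfLang {v : ι → ℝ | 0 ≤ MvPolynomial.aeval v p} := by
  obtain ⟨t, ht⟩ := exists_term_realize_eq_aeval F p
  obtain ⟨u, hu⟩ := exists_term_realize_eq_aeval F (0 : MvPolynomial ι (Subring.closure F))
  refine ⟨Language.Relations.formula (L := rcfLang[[F]])
    (Sum.inl (Sum.inr Language.orderRel.le)) ![u, t], ?_⟩
  ext v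
  have h0 : u.realize v = 0 := by rw [hu, map_zero]
  rw [Set.mem_ofPred_eq, ← ht v, ← h0, Set.mem_ofPred_eq]
  exact (Language.Formula.realize_rel (L := rcfLang[[F]]) (M := ℝ)
    (R := Sum.inl (Sum.inr Language.orderRel.le)) (ts := ![u, t]) (v := v)).symm

theorem definable_aeval_pos (F : Set ℝ) {ι : Type*} (p : MvPolynomial ι (Subring.closure F)) :
    F.Definable rcfLang {v : ι → ℝ | 0 < MvPolynomial.aeval v p} := by
  convert (definable_aeval_nonneg F (-p)).compl using 1
  ext v
  simp

theorem definable_rat_lt (F : Set ℝ) {ι : Type*} (a : ℚ) (i : ι) :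
    F.Definable rcfLang {z : ι → ℝ | (a : ℝ) < z i} := by
  convert definable_aeval_pos F
    ((a.den : MvPolynomial ι (Subring.closure F)) * MvPolynomial.X i - (a.num : MvPolynomial ι _))
    using 1
  ext z
  have hden : (0 : ℝ) < a.den := by exact_mod_cast a.den_pos
  simp only [Set.mem_ofPred_eq, map_sub, map_mul, map_natCast, MvPolynomial.aeval_X, map_intCast,
    sub_pos]
  rw [← div_lt_iff₀' hden, ← Rat.cast_def]

theorem definable_lt_rat (F : Set ℝ) {ι : Type*} (a : ℚ) (i : ι) :
    F.Definable rcfLang {z : ι → ℝ | z i < (a : ℝ)} := by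
  convert definable_aeval_pos F
    ((a.num : MvPolynomial ι (Subring.closure F)) - (a.den : MvPolynomial ι _) * MvPolynomial.X i)
    using 1
  ext z
  have hden : (0 : ℝ) < a.den := by exact_mod_cast a.den_pos
  simp only [Set.mem_ofPred_eq, map_sub, map_mul, map_natCast, MvPolynomial.aeval_X, map_intCast,
    sub_pos]
  rw [← lt_div_iff₀' hden, ← Rat.cast_def]

/-- Boxes with rational end points form a neighbourhood basis of definable sets. -/
theorem exists_definable_nhds_subset (F : Set ℝ) {d : ℕ} {x : Fin d → ℝ} {U : Set (Fin d → ℝ)}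
    (hU : U ∈ nhds x) : ∃ V ∈ nhds x, V ⊆ U ∧ F.Definable rcfLang V := by
  obtain ⟨ε, hε, hεU⟩ := Metric.mem_nhds_iff.1 hU
  have h1 : ∀ i, ∃ a : ℚ, x i - ε < a ∧ (a : ℝ) < x i := fun i => exists_rat_btwn (by linarith)
  have h2 : ∀ i, ∃ a : ℚ, x i < a ∧ (a : ℝ) < x i + ε := fun i => exists_rat_btwn (by linarith)
  choose a ha1 ha2 using h1
  choose b hb1 hb2 using h2
  refine ⟨Set.pi Set.univ fun i => Set.Ioo (a i : ℝ) (b i), ?_, fun z hz => hεU ?_, ?_⟩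
  · exact set_pi_mem_nhds Set.finite_univ fun i _ => Ioo_mem_nhds (ha2 i) (hb1 i)
  · rw [Metric.mem_ball, dist_pi_lt_iff hε]
    intro i
    have := hz i trivial
    rw [Real.dist_eq, abs_lt]
    constructor <;> linarith [this.1, this.2, ha1 i, hb2 i]
  · have : (Set.pi Set.univ fun i => Set.Ioo (a i : ℝ) (b i)) =
        ⋂ i, ({z : Fin d → ℝ | (a i : ℝ) < z i} ∩ {z | z i < (b i : ℝ)}) := by
      ext z
      simp [Set.mem_pi]
    rw [this]
    exact Set.definable_iInter_of_finite fun i =>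
      (definable_rat_lt F (a i) i).inter (definable_lt_rat F (b i) i)

/-! ### Zariski closures -/

open MvPolynomial in
/-- Over the reals, a zero locus is the zero set of a single polynomial, a sum of squares of
generators of the ideal. -/
theorem isAlgebraicSet_zeroLocus {d : ℕ} (J : Ideal (MvPolynomial (Fin d) ℝ)) :
    IsAlgebraicSet (zeroLocus ℝ J) := by
  obtain ⟨T, rfl⟩ := (isNoetherianRing_iff_ideal_fg _).1 inferInstance J
  refine ⟨∑ t ∈ T, t ^ 2, ?_⟩
  ext z
  rw [zeroLocus_span, Set.mem_ofPred_eq, Set.mem_ofPred_eq, map_sum,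
    Finset.sum_eq_zero_iff_of_nonneg fun t _ => by rw [map_pow]; positivity]
  simp [aeval_eq_eval]

open MvPolynomial in
/-- The Zariski closure of a definable set is definable over the same parameters: the polynomials
vanishing on the set are generated in bounded degree, so it suffices to quantify over finitely many
coefficients. -/
theorem IsSemialgebraicOver.zeroLocus_vanishingIdeal {d : ℕ} {F : Set ℝ} {S : Set (Fin d → ℝ)}
    (hS : IsSemialgebraicOver F S) :
    IsSemialgebraicOver F (zeroLocus ℝ (vanishingIdeal ℝ S)) := by
  classical
  obtain ⟨T, hT⟩ := (isNoetherianRing_iff_ideal_fg _).1 inferInstance (vanishingIdeal ℝ S)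
  set M : Finset (Fin d →₀ ℕ) := T.biUnion fun t => t.support with hM
  let U : MvPolynomial (M ⊕ Fin d) (Subring.closure F) :=
    ∑ m : M, X (Sum.inl m) * ∏ i, X (Sum.inr i) ^ (m.1 i)
  have hU : ∀ (c : M → ℝ) (z : Fin d → ℝ),
      aeval (Sum.elim c z) U = ∑ m : M, c m * ∏ i, z i ^ (m.1 i) := by
    intro c z
    simp [U]
  have hmem : ∀ y, y ∈ zeroLocus ℝ (vanishingIdeal ℝ S) ↔ ∀ c : M → ℝ,
      (∀ z ∈ S, aeval (Sum.elim c z) U = 0) → aeval (Sum.elim c y) U = 0 := by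
    intro y
    constructor
    · intro hy c hc
      have key : ∀ z : Fin d → ℝ, aeval z (∑ m : M, monomial m.1 (c m)) =
          aeval (Sum.elim c z) U := by
        intro z
        rw [hU, map_sum]
        refine Finset.sum_congr rfl fun m _ => ?_
        rw [aeval_monomial, Finsupp.prod_fintype _ _ (fun i => pow_zero _)]
        simp
      rw [← key]
      refine hy _ ?_
      rw [mem_vanishingIdeal_iff]
      exact fun z hz => (key z).trans (hc z hz)
    · intro h
      rw [← hT, zeroLocus_span]
      intro t ht
      have key : ∀ z : Fin d → ℝ, aeval z t = aeval (Sum.elim (fun m : M => coeff m.1 t) z) U := by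
        intro z
        rw [hU, aeval_eq_eval, eval_eq', Finset.sum_coe_sort M
          fun m => coeff m t * ∏ i, z i ^ (m i)]
        refine Finset.sum_subset (Finset.subset_biUnion_of_mem (fun t => t.support) ht) ?_
        intro m _ hm
        rw [notMem_support_iff.1 hm, zero_mul]
      rw [key]
      refine h _ fun z hz => ?_
      rw [← key]
      have : t ∈ vanishingIdeal ℝ S := hT ▸ Ideal.subset_span ht
      exact (mem_vanishingIdeal_iff.1 this) z hz
  have h1 : F.Definable rcfLang {v : M ⊕ Fin d → ℝ | v ∘ Sum.inr ∈ S → aeval v U = 0} := by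
    have := ((hS.preimage_comp (Sum.inr : Fin d → M ⊕ Fin d)).compl).union
      (definable_aeval_eq_zero F U)
    convert this using 1
    ext v
    simp [imp_iff_not_or]
  have h2 := h1.forall_of_finite
  have h3 : F.Definable rcfLang {v : Fin d ⊕ M → ℝ |
      (v ∘ Sum.inr ∈ {c : M → ℝ | ∀ z : Fin d → ℝ,
        Sum.elim c z ∈ {v : M ⊕ Fin d → ℝ | v ∘ Sum.inr ∈ S → aeval v U = 0}}) →
      aeval (v ∘ Sum.swap) U = 0} := by
    have := ((h2.preimage_comp (Sum.inr : M → Fin d ⊕ M)).compl).union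
      ((definable_aeval_eq_zero F U).preimage_comp (Sum.swap : M ⊕ Fin d → Fin d ⊕ M))
    convert this using 1
    ext v
    simp only [imp_iff_not_or]
    rfl
  have h4 := h3.forall_of_finite
  refine (congrArg (F.Definable rcfLang) ?_).mp h4
  ext y
  rw [hmem]
  simp [Sum.elim_comp_inr]

/-! ### Krull dimension and transcendence degree -/

theorem ringKrullDim_eq_of_isIntegral (R S : Type*) [CommRing R] [CommRing S] [Algebra R S]
    [Algebra.IsIntegral R S] [FaithfulSMul R S] : ringKrullDim S = ringKrullDim R := by
  apply le_antisymm
  · refine Order.krullDim_le_of_strictMono (PrimeSpectrum.comap (algebraMap R S)) ?_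
    intro P Q hPQ
    obtain ⟨x, hxQ, hxP⟩ := SetLike.exists_of_lt (show P.asIdeal < Q.asIdeal from hPQ)
    exact Ideal.comap_lt_comap_of_integral_mem_sdiff (show P.asIdeal ≤ Q.asIdeal from hPQ.le)
      ⟨hxQ, hxP⟩ (Algebra.IsIntegral.isIntegral x)
  · refine iSup_le fun l => ?_
    obtain ⟨Q, -, hQ, hQl⟩ := Ideal.exists_ideal_over_prime_of_isIntegral (S := S)
      (RelSeries.head l).asIdeal ⊥ (by
        rw [← RingHom.ker_eq_comap_bot,
          (RingHom.injective_iff_ker_eq_bot _).1 (FaithfulSMul.algebraMap_injective R S)]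
        exact bot_le)
    have : Q.LiesOver (RelSeries.head l).asIdeal := ⟨hQl.symm⟩
    obtain ⟨L, hL, -, -⟩ := Ideal.exists_ltSeries_of_hasGoingUp (S := S) l Q
    rw [← hL]
    exact Order.LTSeries.length_le_krullDim L

/-- The Krull dimension of a finitely generated domain over a field is its transcendence degree. -/
theorem ringKrullDim_eq_card_of_isTranscendenceBasis {k B ι : Type*} [Field k] [CommRing B]
    [IsDomain B] [Algebra k B] [Algebra.FiniteType k B] [Fintype ι] {b : ι → B}
    (hb : IsTranscendenceBasis k b) : ringKrullDim B = (Fintype.card ι : ℕ) := by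
  obtain ⟨s, g, hg, hgi⟩ := exists_integral_inj_algHom_of_fg k B
  let _ := g.toRingHom.toAlgebra
  have : IsScalarTower k (MvPolynomial (Fin s) k) B :=
    IsScalarTower.of_algebraMap_eq fun x => (g.commutes x).symm
  have : Algebra.IsIntegral (MvPolynomial (Fin s) k) B := ⟨hgi⟩
  have : FaithfulSMul (MvPolynomial (Fin s) k) B :=
    (faithfulSMul_iff_algebraMap_injective _ _).2 hg
  have hs := (IsTranscendenceBasis.mvPolynomial (Fin s) k).algebraMap_comp (A := B)
  have hcard : s = Fintype.card ι := by
    have := hs.lift_cardinalMk_eq hb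
    simpa using this
  rw [ringKrullDim_eq_of_isIntegral (MvPolynomial (Fin s) k) B,
    MvPolynomial.ringKrullDim_of_isNoetherianRing, ringKrullDim_eq_zero_of_field, zero_add,
    Nat.card_eq_fintype_card, Fintype.card_fin, hcard]

/-! ### Algebraic elements over a real closed field -/

open IntermediateField in
/-- A field of characteristic zero over which every polynomial of odd degree has a root has no
finite extension of odd degree greater than one. -/
theorem finrank_eq_one_of_odd {K M : Type*} [Field K] [CharZero K] [Field M] [Algebra K M]
    [FiniteDimensional K M]
    (hodd : ∀ f : Polynomial K, Odd f.natDegree → ∃ r, f.IsRoot r)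
    (h : Odd (Module.finrank K M)) : Module.finrank K M = 1 := by
  obtain ⟨α, hα⟩ := Field.exists_primitive_element K M
  have hint : IsIntegral K α := Algebra.IsIntegral.isIntegral α
  have hdeg : (minpoly K α).natDegree = Module.finrank K M := by
    rw [← adjoin.finrank hint, hα, finrank_top']
  obtain ⟨r, hr⟩ := hodd (minpoly K α) (hdeg ▸ h)
  rw [← hdeg]
  exact Polynomial.natDegree_eq_of_degree_eq_some
    (Polynomial.degree_eq_one_of_irreducible_of_root (minpoly.irreducible hint) hr)

/-- A quadratic extension is generated by a square root. -/
theorem exists_isSquare_of_finrank_eq_two {K M : Type*} [Field K] [CharZero K] [Field M]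
    [Algebra K M] (h : Module.finrank K M = 2) :
    ∃ a : K, IsSquare (algebraMap K M a) ∧ ¬ IsSquare a := by
  have hfd : FiniteDimensional K M := Module.finite_of_finrank_eq_succ h
  obtain ⟨α, hα⟩ : ∃ α : M, α ∉ (⊥ : IntermediateField K M) := by
    by_contra! hcon
    have : (⊥ : IntermediateField K M) = ⊤ := by
      ext x
      simp [hcon x]
    have h1 := IntermediateField.finrank_bot (F := K) (E := M)
    rw [this, IntermediateField.finrank_top', h] at h1
    omega
  have hint : IsIntegral K α := Algebra.IsIntegral.isIntegral α
  have h2 : (minpoly K α).natDegree = 2 := by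
    have hle : (minpoly K α).natDegree ≤ 2 := h ▸ minpoly.natDegree_le α
    have hpos := minpoly.natDegree_pos hint
    have hne : (minpoly K α).natDegree ≠ 1 := fun h1 => hα <| by
      rw [minpoly.natDegree_eq_one_iff] at h1
      obtain ⟨c, hc⟩ := h1
      exact IntermediateField.mem_bot.2 ⟨c, hc⟩
    omega
  set b := (minpoly K α).coeff 1
  set c := (minpoly K α).coeff 0
  have hroot : α ^ 2 + algebraMap K M b * α + algebraMap K M c = 0 := by
    have h3 := minpoly.aeval K α
    have hm := minpoly.monic hint
    rw [Polynomial.Monic, Polynomial.leadingCoeff, h2] at hm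
    rw [Polynomial.aeval_eq_sum_range, h2] at h3
    simp only [Finset.sum_range_succ, Finset.sum_range_zero, hm, Algebra.smul_def] at h3
    simp only [pow_zero, pow_one, map_one, one_mul, mul_one, zero_add] at h3
    rw [← h3]
    ring
  refine ⟨b ^ 2 - 4 * c, ⟨2 * α + algebraMap K M b, ?_⟩, ?_⟩
  · simp only [map_sub, map_mul, map_pow, map_ofNat]
    linear_combination (-4) * hroot
  · rintro ⟨e, he⟩
    have hfac : (2 * α + algebraMap K M b - algebraMap K M e) *
        (2 * α + algebraMap K M b + algebraMap K M e) = 0 := by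
      have := congrArg (algebraMap K M) he
      simp only [map_sub, map_mul, map_pow, map_ofNat] at this
      linear_combination 4 * hroot + this
    have hcz : (2 : M) ≠ 0 := by
      rw [← map_ofNat (algebraMap K M) 2, Ne, map_eq_zero]
      exact two_ne_zero
    rcases mul_eq_zero.1 hfac with h | h
    · refine hα (IntermediateField.mem_bot.2 ⟨(e - b) / 2, ?_⟩)
      rw [map_div₀, map_sub, map_ofNat, div_eq_iff hcz]
      linear_combination -h
    · refine hα (IntermediateField.mem_bot.2 ⟨(-e - b) / 2, ?_⟩)
      rw [map_div₀, map_sub, map_neg, map_ofNat, div_eq_iff hcz]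
      linear_combination -h

open IntermediateField in
/-- If odd degree polynomials over `K` have roots, a finite extension of `K` in which no new element
of `K` becomes a square is trivial: the Galois group of the normal closure is a `2`-group, so a
proper subextension would contain a quadratic one. -/
theorem finrank_eq_one_of_isSquare {K L : Type*} [Field K] [CharZero K] [Field L] [Algebra K L]
    [FiniteDimensional K L]
    (hodd : ∀ f : Polynomial K, Odd f.natDegree → ∃ r, f.IsRoot r)
    (hsq : ∀ a : K, IsSquare (algebraMap K L a) → IsSquare a) : Module.finrank K L = 1 := by
  let N := normalClosure K L (AlgebraicClosure L)
  have : IsGalois K N := ⟨⟩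
  let j : L →ₐ[K] N := IsScalarTower.toAlgHom K L N
  set L' : IntermediateField K N := j.fieldRange with hL'
  let G := N ≃ₐ[K] N
  have hL : Module.finrank K L' = Module.finrank K L :=
    (AlgEquiv.ofInjectiveField j).toLinearEquiv.finrank_eq.symm
  have hfact : Fact (Nat.Prime 2) := ⟨Nat.prime_two⟩
  obtain ⟨P⟩ : Nonempty (Sylow 2 G) := inferInstance
  have hidx : ∀ H : Subgroup G, Module.finrank K (fixedField H) = H.index := by
    intro H
    have h1 := Module.finrank_mul_finrank K (fixedField H) N
    rw [finrank_fixedField_eq_card, ← IsGalois.card_aut_eq_finrank K N, ← H.index_mul_card] at h1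
    exact Nat.eq_of_mul_eq_mul_right Nat.card_pos h1
  -- The fixed field of a Sylow `2`-subgroup has odd degree, so it is `K`.
  have hP : (P : Subgroup G).index = 1 := by
    rw [← hidx]
    refine finrank_eq_one_of_odd hodd ?_
    rw [hidx, ← Nat.not_even_iff_odd, even_iff_two_dvd]
    exact P.not_dvd_index
  obtain ⟨m, hm⟩ : ∃ m, Nat.card G = 2 ^ m := by
    obtain ⟨m, hm⟩ := IsPGroup.iff_card.1 P.isPGroup'
    refine ⟨m, ?_⟩
    rw [← hm, ← (P : Subgroup G).card_mul_index, hP, mul_one]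
  set H := L'.fixingSubgroup with hH
  obtain ⟨n, hnm, hn⟩ := (Nat.dvd_prime_pow Nat.prime_two).1 (hm ▸ Subgroup.card_subgroup_dvd_card H)
  have hL'H : fixedField H = L' := IsGalois.fixedField_fixingSubgroup L'
  rcases hnm.eq_or_lt with rfl | hlt
  · rw [← hL, ← hL'H, hidx, Subgroup.index_eq_one, ← Subgroup.card_eq_iff_eq_top, hn, hm]
  -- The fixing subgroup of `L` is contained in a subgroup of index two.
  · obtain ⟨H', hH', hHH'⟩ := Sylow.exists_subgroup_card_pow_prime_le 2
      (n := n) (m := m - 1) (G := G) (hm ▸ pow_dvd_pow 2 (by omega)) H hn (by omega)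
    have h2 : Module.finrank K (fixedField H') = 2 := by
      rw [hidx]
      have h3 := H'.card_mul_index
      have h4 : 2 ^ m = 2 ^ (m - 1) * 2 := by rw [← pow_succ, Nat.sub_add_cancel (by omega)]
      rw [hH', hm, h4] at h3
      exact Nat.eq_of_mul_eq_mul_left (by positivity) h3
    obtain ⟨a, ha, hna⟩ := exists_isSquare_of_finrank_eq_two h2
    exfalso
    apply hna
    apply hsq
    have hle : fixedField H' ≤ L' := by
      rw [← hL'H, IntermediateField.le_iff_le, IntermediateField.fixingSubgroup_fixedField]
      exact hHH'
    obtain ⟨u, hu⟩ := ha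
    obtain ⟨v, hv⟩ := hle u.2
    refine ⟨v, j.injective ?_⟩
    change j (algebraMap K L a) = j (v * v)
    have h3 := congrArg (fun z : fixedField H' => (z : N)) hu
    have h4 : algebraMap K N a = (u : N) * u := h3
    rw [j.commutes, h4, map_mul]
    exact (congrArg₂ (· * ·) hv hv).symm

/-- A real closed subfield of `ℝ` is algebraically closed in `ℝ`: its elements which are squares in
`ℝ` are nonnegative, hence squares already in the subfield. -/
theorem mem_of_isAlgebraic_of_isRealClosed (K : Subfield ℝ) [IsRealClosed K] {y : ℝ}
    (hy : IsAlgebraic K y) : y ∈ K := by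
  have hint : IsIntegral K y := isAlgebraic_iff_isIntegral.1 hy
  have : FiniteDimensional K (IntermediateField.adjoin K {y}) :=
    IntermediateField.adjoin.finiteDimensional hint
  have h1 : Module.finrank K (IntermediateField.adjoin K {y}) = 1 := by
    refine finrank_eq_one_of_isSquare
      (fun f hf => IsRealClosed.exists_isRoot_of_odd_natDegree hf) fun a ha => ?_
    obtain ⟨u, hu⟩ := ha
    have ha0 : 0 ≤ (a : ℝ) := by
      have := congrArg (fun z : IntermediateField.adjoin K {y} => (z : ℝ)) hu
      have h2 : (a : ℝ) = (u : ℝ) * u := this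
      rw [h2]
      exact mul_self_nonneg _
    rcases IsRealClosed.isSquare_or_isSquare_neg a with h | ⟨e, he⟩
    · exact h
    · have he' : -(a : ℝ) = (e : ℝ) * e := congrArg (fun z : K => (z : ℝ)) he
      have : (a : ℝ) = 0 := by nlinarith [mul_self_nonneg (e : ℝ)]
      have : a = 0 := Subtype.ext this
      exact this ▸ IsSquare.zero
  rw [IntermediateField.finrank_adjoin_simple_eq_one_iff, IntermediateField.mem_bot] at h1
  obtain ⟨c, rfl⟩ := h1
  exact c.2

/-! ### Separable relations over a transcendence basis of coordinates -/

/-- Some of the coordinates of a real point `x` are algebraically independent over `k`, and each of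
the others is a simple root of a polynomial over the polynomial ring in the former ones. -/
theorem exists_algebraicIndepOn_and_simple_root (k : Subring ℝ) {d : ℕ} (x : Fin d → ℝ) :
    ∃ s : Set (Fin d), AlgebraicIndepOn k x s ∧ ∀ j ∉ s,
      ∃ q : Polynomial (MvPolynomial s k), q ≠ 0 ∧
        q.eval₂ (MvPolynomial.aeval (R := k) fun i : s => x i).toRingHom (x j) = 0 ∧
        q.derivative.eval₂ (MvPolynomial.aeval (R := k) fun i : s => x i).toRingHom (x j) ≠ 0 := by
  classical
  obtain ⟨s, hs⟩ := (Set.toFinite {s : Set (Fin d) | AlgebraicIndepOn k x s}).exists_maximal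
    ⟨∅, by
      rw [Set.mem_ofPred_eq, AlgebraicIndepOn, algebraicIndependent_empty_type_iff]
      exact Subtype.val_injective⟩
  have hind : AlgebraicIndepOn k x s := hs.prop
  refine ⟨s, hind, fun j hj => ?_⟩
  set ev := (MvPolynomial.aeval (R := k) fun i : s => x i).toRingHom with hev
  have hinj : Function.Injective ev := hind
  have hex : ∃ q : Polynomial (MvPolynomial s k), q ≠ 0 ∧ q.eval₂ ev (x j) = 0 := by
    have hnot : ¬ AlgebraicIndepOn k x (insert j s) := fun h =>
      hj (hs.le_of_ge h (Set.subset_insert j s) (Set.mem_insert j s))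
    rw [AlgebraicIndepOn.insert_iff hj, not_and] at hnot
    obtain ⟨p, hp0, hp⟩ := not_not.1 (hnot hind)
    let e := hind.aevalEquiv
    refine ⟨p.map (e.symm : _ →+* MvPolynomial s k), ?_, ?_⟩
    · exact fun h => hp0 (Polynomial.map_injective (e.symm : _ →+* MvPolynomial s k)
        e.symm.injective (h.trans (Polynomial.map_zero _).symm))
    · have hcomp : ev.comp (e.symm : _ →+* MvPolynomial s k) =
          algebraMap (Algebra.adjoin k (x '' s)) ℝ := by
        refine RingHom.ext fun c => ?_
        obtain ⟨c, rfl⟩ := e.surjective c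
        simp only [RingHom.comp_apply, RingHom.coe_coe, AlgEquiv.symm_apply_apply]
        exact (hind.algebraMap_aevalEquiv c).symm
      rw [Polynomial.eval₂_map, hcomp]
      exact hp
  -- A relation of minimal degree is not annihilated along with its derivative.
  obtain ⟨q, ⟨hq0, hq⟩, hmin⟩ := WellFounded.has_min (measure Polynomial.natDegree).wf
    {q : Polynomial (MvPolynomial s k) | q ≠ 0 ∧ q.eval₂ ev (x j) = 0} hex
  have hdeg : q.natDegree ≠ 0 := by
    intro h
    rw [Polynomial.eq_C_of_natDegree_eq_zero h, Polynomial.eval₂_C] at hq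
    apply hq0
    rw [Polynomial.eq_C_of_natDegree_eq_zero h, (map_eq_zero_iff ev hinj).1 hq, Polynomial.C_0]
  refine ⟨q, hq0, hq, fun h => ?_⟩
  exact hmin _ ⟨fun h0 => hdeg (Polynomial.derivative_eq_zero.1 h0), h⟩
    (Polynomial.natDegree_derivative_lt hdeg)

/-- The polynomial `q(X_s, X_j)` in all variables obtained from a polynomial `q(T)` over the
polynomial ring in the variables indexed by `s`. -/
noncomputable def substVar {k : Type*} [CommRing k] {d : ℕ} {s : Set (Fin d)} (j : Fin d)
    (q : Polynomial (MvPolynomial s k)) : MvPolynomial (Fin d) k :=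
  q.eval₂ (MvPolynomial.rename (R := k) (Subtype.val : s → Fin d)).toRingHom (MvPolynomial.X j)

theorem eval₂Hom_substVar {k R : Type*} [CommRing k] [CommRing R] {d : ℕ} {s : Set (Fin d)}
    (j : Fin d) (q : Polynomial (MvPolynomial s k)) (c : k →+* R) (z : Fin d → R) :
    MvPolynomial.eval₂Hom c z (substVar j q) =
      q.eval₂ (MvPolynomial.eval₂Hom c fun i : s => z i) (z j) := by
  rw [substVar, Polynomial.hom_eval₂, MvPolynomial.eval₂Hom_X']
  congr 1
  refine MvPolynomial.ringHom_ext (fun r => ?_) fun i => ?_ <;> simp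

theorem pderiv_rename_of_notMem {k : Type*} [CommRing k] {d : ℕ} {s : Set (Fin d)} {l : Fin d}
    (hl : l ∉ s) (a : MvPolynomial s k) :
    MvPolynomial.pderiv l (MvPolynomial.rename (Subtype.val : s → Fin d) a) = 0 := by
  induction a using MvPolynomial.induction_on with
  | C r => simp
  | add p q hp hq => rw [map_add, map_add, hp, hq, add_zero]
  | mul_X p i hp =>
    have hne : (i : Fin d) ≠ l := fun h => hl (h ▸ i.2)
    rw [map_mul, Derivation.leibniz, hp, MvPolynomial.rename_X, MvPolynomial.pderiv_X_of_ne hne]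
    simp

theorem pderiv_substVar_self {k : Type*} [CommRing k] {d : ℕ} {s : Set (Fin d)} {j : Fin d}
    (hj : j ∉ s) (q : Polynomial (MvPolynomial s k)) :
    MvPolynomial.pderiv j (substVar j q) = substVar j q.derivative := by
  simp only [substVar]
  induction q using Polynomial.induction_on' with
  | add p q hp hq =>
    rw [Polynomial.eval₂_add, map_add, hp, hq, Polynomial.derivative_add, Polynomial.eval₂_add]
  | monomial n a =>
    rw [Polynomial.eval₂_monomial, Polynomial.derivative_monomial, Polynomial.eval₂_monomial]
    have := pderiv_rename_of_notMem hj a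
    simp only [AlgHom.toRingHom_eq_coe, RingHom.coe_coe, Derivation.leibniz, this,
      Derivation.leibniz_pow, MvPolynomial.pderiv_X_self, map_mul, map_natCast]
    simp only [smul_eq_mul, nsmul_eq_mul]
    ring

theorem pderiv_substVar_of_ne {k : Type*} [CommRing k] {d : ℕ} {s : Set (Fin d)} {j l : Fin d}
    (hl : l ∉ s) (hlj : l ≠ j) (q : Polynomial (MvPolynomial s k)) :
    MvPolynomial.pderiv l (substVar j q) = 0 := by
  simp only [substVar]
  induction q using Polynomial.induction_on' with
  | add p q hp hq => rw [Polynomial.eval₂_add, map_add, hp, hq, add_zero]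
  | monomial n a =>
    rw [Polynomial.eval₂_monomial]
    have := pderiv_rename_of_notMem hl a
    simp [Derivation.leibniz, this, Derivation.leibniz_pow,
      MvPolynomial.pderiv_X_of_ne (R := k) hlj.symm]

/-! ### Analytic parametrization of a zero set near a nonsingular point -/

theorem hasStrictFDerivAt_eval {d : ℕ} (p : MvPolynomial (Fin d) ℝ) (x : Fin d → ℝ) :
    HasStrictFDerivAt (fun z : Fin d → ℝ => MvPolynomial.eval z p)
      (∑ l, MvPolynomial.eval x (MvPolynomial.pderiv l p) •
        (ContinuousLinearMap.proj l : (Fin d → ℝ) →L[ℝ] ℝ)) x := by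
  induction p using MvPolynomial.induction_on with
  | C r => simpa using hasStrictFDerivAt_const r x
  | add p q hp hq =>
    simp only [map_add, add_smul, Finset.sum_add_distrib]
    exact hp.add hq
  | mul_X p i hp =>
    have h1 : HasStrictFDerivAt (fun z : Fin d → ℝ => z i)
        (ContinuousLinearMap.proj i : (Fin d → ℝ) →L[ℝ] ℝ) x :=
      (ContinuousLinearMap.proj i : (Fin d → ℝ) →L[ℝ] ℝ).hasStrictFDerivAt
    have h2 := hp.mul h1
    have key : (∑ l, MvPolynomial.eval x (MvPolynomial.pderiv l (p * MvPolynomial.X i)) •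
        (ContinuousLinearMap.proj l : (Fin d → ℝ) →L[ℝ] ℝ)) =
        MvPolynomial.eval x p • (ContinuousLinearMap.proj i : (Fin d → ℝ) →L[ℝ] ℝ) +
          x i • ∑ l, MvPolynomial.eval x (MvPolynomial.pderiv l p) •
            (ContinuousLinearMap.proj l : (Fin d → ℝ) →L[ℝ] ℝ) := by
      simp only [Derivation.leibniz, smul_eq_mul, map_add, map_mul, MvPolynomial.eval_X, add_smul,
        Finset.sum_add_distrib, Finset.smul_sum, smul_smul]
      congr 1
      rw [Finset.sum_eq_single i]
      · simp
      · intro b _ hb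
        simp [MvPolynomial.pderiv_X_of_ne hb.symm]
      · simp
    rw [key]
    simp only [map_mul, MvPolynomial.eval_X]
    exact h2

/-- Implicit function theorem: if `g j`, for `j ∉ s`, vanishes at `x` and depends only on the
variables in `s` and on the `j`-th one, with nonzero partial derivative with respect to the latter
at `x`, then the common zero set of these polynomials near `x` is the graph of an analytic map of
the coordinates in `s`. -/
theorem exists_analytic_parametrization {d : ℕ} (s : Set (Fin d)) [Fintype s] (x : Fin d → ℝ)
    (g : Fin d → MvPolynomial (Fin d) ℝ)
    (h0 : ∀ j ∉ s, MvPolynomial.eval x (g j) = 0)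
    (h1 : ∀ j ∉ s, MvPolynomial.eval x (MvPolynomial.pderiv j (g j)) ≠ 0)
    (h2 : ∀ j ∉ s, ∀ l ∉ s, l ≠ j → MvPolynomial.pderiv l (g j) = 0) :
    ∃ (H : (s → ℝ) → Fin d → ℝ) (W : Set (s → ℝ)), IsOpen W ∧ IsPreconnected W ∧
      (fun i : s => x i) ∈ W ∧ (∀ i, AnalyticOnNhd ℝ (fun y => H y i) W) ∧
      (∀ y ∈ W, ∀ i : s, H y i = y i) ∧
      (∀ y ∈ W, ∀ j ∉ s, MvPolynomial.eval (H y) (g j) = 0) ∧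
      H (fun i : s => x i) = x ∧
      ∀ᶠ z in nhds x, (∀ j ∉ s, MvPolynomial.eval z (g j) = 0) →
        (fun i : s => z i) ∈ W ∧ H (fun i : s => z i) = z := by
  classical
  -- The map `G` keeps the coordinates in `s` and replaces the others by the values of the `g j`. The
  -- parametrization is its local inverse on the coordinate subspace of `s`.
  let γ : Fin d → MvPolynomial (Fin d) ℝ := fun i => if i ∈ s then MvPolynomial.X i else g i
  have hγs : ∀ i ∈ s, γ i = MvPolynomial.X i := fun i hi => if_pos hi
  have hγn : ∀ i ∉ s, γ i = g i := fun i hi => if_neg hi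
  let G : (Fin d → ℝ) → Fin d → ℝ := fun z i => MvPolynomial.eval z (γ i)
  let L : (Fin d → ℝ) →L[ℝ] Fin d → ℝ := ContinuousLinearMap.pi fun i =>
    ∑ l, MvPolynomial.eval x (MvPolynomial.pderiv l (γ i)) •
      (ContinuousLinearMap.proj l : (Fin d → ℝ) →L[ℝ] ℝ)
  have hL : ∀ v i, L v i = ∑ l, MvPolynomial.eval x (MvPolynomial.pderiv l (γ i)) * v l := by
    intro v i
    simp [L]
  have hLinj : Function.Injective (L : (Fin d → ℝ) →ₗ[ℝ] Fin d → ℝ) := by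
    rw [← LinearMap.ker_eq_bot, LinearMap.ker_eq_bot']
    intro v hv
    have hv' : ∀ i, ∑ l, MvPolynomial.eval x (MvPolynomial.pderiv l (γ i)) * v l = 0 := by
      intro i
      rw [← hL]
      exact congrFun hv i
    have hvs : ∀ i ∈ s, v i = 0 := by
      intro i hi
      have := hv' i
      rw [hγs i hi, Finset.sum_eq_single i] at this
      · simpa using this
      · intro b _ hb
        rw [MvPolynomial.pderiv_X_of_ne hb.symm, map_zero, zero_mul]
      · simp
    funext j
    by_cases hj : j ∈ s
    · exact hvs j hj
    have := hv' j
    rw [hγn j hj, Finset.sum_eq_single j] at this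
    · exact (mul_eq_zero.1 this).resolve_left (h1 j hj)
    · intro l _ hl
      by_cases hls : l ∈ s
      · rw [hvs l hls, mul_zero]
      · rw [h2 j hj l hls hl, map_zero, zero_mul]
    · simp
  let e : (Fin d → ℝ) ≃L[ℝ] (Fin d → ℝ) :=
    (LinearEquiv.ofInjectiveEndo _ hLinj).toContinuousLinearEquiv
  have he : (e : (Fin d → ℝ) →L[ℝ] Fin d → ℝ) = L := by
    ext v i
    rfl
  have hG : HasStrictFDerivAt G (e : (Fin d → ℝ) →L[ℝ] Fin d → ℝ) x := by
    rw [he]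
    exact hasStrictFDerivAt_pi.2 fun i => hasStrictFDerivAt_eval (γ i) x
  have hGan : AnalyticAt ℝ G x := by
    rw [analyticAt_pi_iff]
    exact fun i => AnalyticAt.aeval_mvPolynomial (A := ℝ)
      (fun i => (ContinuousLinearMap.proj i : (Fin d → ℝ) →L[ℝ] ℝ).analyticAt x) (γ i)
  let Φ := hG.toOpenPartialHomeomorph G
  have hxs : x ∈ Φ.source := hG.mem_toOpenPartialHomeomorph_source
  have hΦan : AnalyticAt ℝ Φ.symm (Φ x) := Φ.analyticAt_symm' hxs hGan hG.hasFDerivAt.fderiv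
  let ext0 : (s → ℝ) →L[ℝ] Fin d → ℝ := ContinuousLinearMap.pi fun i =>
    if h : i ∈ s then (ContinuousLinearMap.proj (⟨i, h⟩ : s) : (s → ℝ) →L[ℝ] ℝ) else 0
  have hexts : ∀ y (i : s), ext0 y i = y i := fun y i => by simp [ext0]
  have hextn : ∀ y, ∀ i ∉ s, ext0 y i = 0 := fun y i hi => by simp [ext0, hi]
  have hext : ∀ z, (∀ j ∉ s, MvPolynomial.eval z (g j) = 0) → ext0 (fun i : s => z i) = Φ z := by
    intro z hz
    funext i
    change _ = MvPolynomial.eval z (γ i)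
    by_cases hi : i ∈ s
    · rw [hγs i hi, MvPolynomial.eval_X]
      exact hexts _ ⟨i, hi⟩
    · rw [hγn i hi, hz i hi, hextn _ i hi]
  set y0 : s → ℝ := fun i => x i with hy0
  have hexty0 : ext0 y0 = Φ x := hext x h0
  let H : (s → ℝ) → Fin d → ℝ := fun y => Φ.symm (ext0 y)
  have hHan : AnalyticAt ℝ H y0 :=
    AnalyticAt.comp (g := Φ.symm) (f := ext0) (hexty0 ▸ hΦan) (ext0.analyticAt y0)
  have htarget : ∀ᶠ y in nhds y0, ext0 y ∈ Φ.target := by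
    refine ext0.continuous.continuousAt.eventually (Φ.open_target.mem_nhds ?_)
    rw [hexty0]
    exact Φ.map_source hxs
  obtain ⟨ε, hε, hW⟩ := Metric.eventually_nhds_iff_ball.1 (hHan.eventually_analyticAt.and htarget)
  have hGH : ∀ y ∈ Metric.ball y0 ε, G (H y) = ext0 y := fun y hy => Φ.right_inv (hW y hy).2
  refine ⟨H, Metric.ball y0 ε, Metric.isOpen_ball, (convex_ball y0 ε).isPreconnected,
    Metric.mem_ball_self hε, fun i y hy => (analyticAt_pi_iff.1 (hW y hy).1) i, ?_, ?_, ?_, ?_⟩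
  · intro y hy i
    have := congrFun (hGH y hy) i
    rw [hexts] at this
    rw [← this]
    change _ = MvPolynomial.eval (H y) (γ i)
    rw [hγs i i.2, MvPolynomial.eval_X]
  · intro y hy j hj
    have := congrFun (hGH y hy) j
    rw [hextn y j hj] at this
    change MvPolynomial.eval (H y) (γ j) = 0 at this
    rwa [hγn j hj] at this
  · change Φ.symm (ext0 y0) = x
    rw [hexty0]
    exact Φ.left_inv hxs
  · have hcont : Continuous fun (z : Fin d → ℝ) (i : s) => z i :=
      continuous_pi fun i => continuous_apply _
    filter_upwards [Φ.open_source.mem_nhds hxs,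
      hcont.continuousAt.eventually (Metric.ball_mem_nhds y0 hε)] with z hz hzW hgz
    refine ⟨hzW, ?_⟩
    change Φ.symm (ext0 _) = z
    rw [hext z hgz]
    exact Φ.left_inv hz

/-! ### Analytic functions on a connected open set -/

/-- The algebra of real analytic functions on `W`, as functions on the subtype. -/
def analyticFunctions {E : Type*} [NormedAddCommGroup E] [NormedSpace ℝ E] (W : Set E) :
    Subalgebra ℝ (W → ℝ) where
  carrier := {u | ∃ f : E → ℝ, AnalyticOnNhd ℝ f W ∧ ∀ w : W, u w = f w}
  mul_mem' := by
    rintro u v ⟨f, hf, hu⟩ ⟨g, hg, hv⟩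
    exact ⟨fun y => f y * g y, hf.mul hg, fun w => by rw [Pi.mul_apply, hu, hv]⟩
  add_mem' := by
    rintro u v ⟨f, hf, hu⟩ ⟨g, hg, hv⟩
    exact ⟨fun y => f y + g y, hf.add hg, fun w => by rw [Pi.add_apply, hu, hv]⟩
  algebraMap_mem' r := ⟨fun _ => r, analyticOnNhd_const, fun _ => rfl⟩

/-- By the identity theorem, the analytic functions on a connected open set form a domain. -/
theorem isDomain_analyticFunctions {E : Type*} [NormedAddCommGroup E] [NormedSpace ℝ E]
    {W : Set E} (hW : IsOpen W) (hWc : IsPreconnected W) (hne : W.Nonempty) :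
    IsDomain (analyticFunctions W) := by
  have : Nonempty W := hne.to_subtype
  have : Nontrivial (analyticFunctions W) := inferInstance
  have : NoZeroDivisors (analyticFunctions W) := by
    refine ⟨fun {u v} huv => ?_⟩
    obtain ⟨u, f, hf, hu⟩ := u
    obtain ⟨v, g, hg, hv⟩ := v
    by_cases h : u = 0
    · exact Or.inl (Subtype.ext h)
    right
    obtain ⟨w, hw⟩ := Function.ne_iff.1 h
    have hfw : f w ≠ 0 := by rw [← hu]; exact hw
    have hzero : g =ᶠ[nhds (w : E)] 0 := by
      filter_upwards [(hf w w.2).continuousAt.eventually_ne hfw, hW.mem_nhds w.2] with y hy hyW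
      have h1 := congrFun (congrArg Subtype.val huv) ⟨y, hyW⟩
      change u ⟨y, hyW⟩ * v ⟨y, hyW⟩ = 0 at h1
      rw [hu, hv] at h1
      exact (mul_eq_zero.1 h1).resolve_left hy
    have := hg.eqOn_zero_of_preconnected_of_eventuallyEq_zero hWc w.2 hzero
    exact Subtype.ext (funext fun y => (hv y).trans (this y.2))
  exact NoZeroDivisors.to_isDomain _

/-- A connected analytic graph over the coordinates indexed by `s`: an analytic map from a connected
open set `W` of `ℝ^s` to `ℝ^d` which is a section of the projection. -/
structure IsAnalyticGraph {d : ℕ} {s : Set (Fin d)} [Fintype s] (H : (s → ℝ) → Fin d → ℝ)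
    (W : Set (s → ℝ)) : Prop where
  isOpen : IsOpen W
  isPreconnected : IsPreconnected W
  nonempty : W.Nonempty
  analytic : ∀ i, AnalyticOnNhd ℝ (fun y => H y i) W
  proj : ∀ y ∈ W, ∀ i : s, H y i = y i

namespace IsAnalyticGraph

variable {d : ℕ} {s : Set (Fin d)} [Fintype s] {H : (s → ℝ) → Fin d → ℝ} {W : Set (s → ℝ)}

/-- The coordinate functions of the graph as analytic functions of the parameter. -/
noncomputable def coord (h : IsAnalyticGraph H W) (i : Fin d) : analyticFunctions W :=
  ⟨fun w => H w i, fun y => H y i, h.analytic i, fun _ => rfl⟩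

theorem isDomain (h : IsAnalyticGraph H W) : IsDomain (analyticFunctions W) :=
  isDomain_analyticFunctions h.isOpen h.isPreconnected h.nonempty

/-- Evaluation of analytic functions at a point of the domain. -/
noncomputable def evalAt (w : W) : analyticFunctions W →+* ℝ :=
  (Pi.evalRingHom (fun _ : W => ℝ) w).comp (analyticFunctions W).val.toRingHom

theorem evalAt_coord (h : IsAnalyticGraph H W) (w : W) (i : Fin d) :
    evalAt w (h.coord i) = H w i := rfl

theorem ext_evalAt {u v : analyticFunctions W} (huv : ∀ w : W, evalAt w u = evalAt w v) : u = v :=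
  Subtype.ext (funext huv)

/-- The polynomials vanishing on a connected analytic graph form a prime ideal. -/
theorem isPrime_vanishingIdeal (h : IsAnalyticGraph H W) :
    (MvPolynomial.vanishingIdeal ℝ (H '' W)).IsPrime := by
  have := h.isDomain
  let Ψ : MvPolynomial (Fin d) ℝ →ₐ[ℝ] analyticFunctions W := MvPolynomial.aeval h.coord
  have hΨ : ∀ (w : W) p, evalAt w (Ψ p) = MvPolynomial.aeval (H w) p := by
    intro w p
    have : (evalAt w).comp Ψ.toRingHom = (MvPolynomial.aeval (R := ℝ) (H w)).toRingHom := by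
      refine MvPolynomial.ringHom_ext (fun r => ?_) fun i => ?_
      · simp only [RingHom.comp_apply, AlgHom.toRingHom_eq_coe, RingHom.coe_coe,
          MvPolynomial.algHom_C]
        rfl
      · simp [Ψ, evalAt_coord]
    exact congrArg (fun f => f p) this
  have hker : MvPolynomial.vanishingIdeal ℝ (H '' W) = RingHom.ker Ψ := by
    ext p
    rw [MvPolynomial.mem_vanishingIdeal_iff, RingHom.mem_ker, Set.forall_mem_image]
    constructor
    · intro hp
      exact ext_evalAt fun w => by rw [hΨ, hp w.2, map_zero]
    · intro hp w hw
      rw [← hΨ ⟨w, hw⟩, hp, map_zero]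
  rw [hker]
  exact RingHom.ker_isPrime _

end IsAnalyticGraph

theorem isAlgebraic_eval₂ {A B k σ : Type*} [CommRing A] [IsDomain A] [CommRing B] [Algebra A B]
    [CommRing k] (c : k →+* B) (hc : ∀ r, IsAlgebraic A (c r)) (h : σ → B)
    (hh : ∀ i, IsAlgebraic A (h i)) (p : MvPolynomial σ k) :
    IsAlgebraic A (MvPolynomial.eval₂Hom c h p) := by
  induction p using MvPolynomial.induction_on with
  | C r => rw [MvPolynomial.eval₂Hom_C]; exact hc r
  | add p q hp hq => rw [map_add]; exact hp.add hq
  | mul_X p i hp => rw [map_mul, MvPolynomial.eval₂Hom_X']; exact hp.mul (hh i)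

namespace IsAnalyticGraph

variable {d : ℕ} {s : Set (Fin d)} [Fintype s] {H : (s → ℝ) → Fin d → ℝ} {W : Set (s → ℝ)}

/-- Suppose the coordinates of the graph are algebraic functions over `k` and the parameter `y₀` is
algebraically independent over `k`. A polynomial over `k` vanishing at the point of the graph over
`y₀` then vanishes on the graph: its restriction `u` is an algebraic function, and if it were
nonzero, a polynomial relation for `u` with nonzero constant coefficient would give an algebraic
relation for `y₀`. -/
theorem aeval_eq_zero (h : IsAnalyticGraph H W) {k : Subring ℝ} {y₀ : s → ℝ} (hy₀ : y₀ ∈ W)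
    (hind : AlgebraicIndependent k y₀) (q : Fin d → Polynomial (MvPolynomial s k))
    (hq : ∀ j ∉ s, q j ≠ 0 ∧ ∀ w ∈ W,
      (q j).eval₂ (MvPolynomial.eval₂Hom (algebraMap k ℝ) w) (H w j) = 0)
    {p : MvPolynomial (Fin d) k} (hp : MvPolynomial.aeval (H y₀) p = 0) {w : s → ℝ} (hw : w ∈ W) :
    MvPolynomial.aeval (H w) p = 0 := by
  have := h.isDomain
  let c : k →+* analyticFunctions W := (algebraMap ℝ (analyticFunctions W)).comp (algebraMap k ℝ)
  have hc : ∀ (w : W) (r : k), evalAt w (c r) = algebraMap k ℝ r := fun w r => rfl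
  let θ : MvPolynomial s k →+* analyticFunctions W :=
    MvPolynomial.eval₂Hom c fun i => h.coord i
  have hθ : ∀ w : W, (evalAt w).comp θ = MvPolynomial.eval₂Hom (algebraMap k ℝ) (w : s → ℝ) := by
    intro w
    refine MvPolynomial.ringHom_ext (fun r => ?_) fun i => ?_
    · simp [θ, hc]
    · simp [θ, evalAt_coord, h.proj w w.2]
  let _ := θ.toAlgebra
  have hcoord : ∀ j, IsAlgebraic (MvPolynomial s k) (h.coord j) := by
    intro j
    by_cases hj : j ∈ s
    · have : h.coord j = algebraMap (MvPolynomial s k) _ (MvPolynomial.X ⟨j, hj⟩) := by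
        change _ = θ _
        simp [θ]
      rw [this]
      exact isAlgebraic_algebraMap _
    · refine ⟨q j, (hq j hj).1, ext_evalAt fun w => ?_⟩
      rw [Polynomial.aeval_def, Polynomial.hom_eval₂, map_zero, evalAt_coord]
      change Polynomial.eval₂ ((evalAt w).comp θ) _ _ = 0
      rw [hθ]
      exact (hq j hj).2 w w.2
  set u : analyticFunctions W := MvPolynomial.eval₂Hom c h.coord p with hu
  have hev : ∀ w : W, evalAt w u = MvPolynomial.aeval (H w) p := by
    intro w
    have : (evalAt w).comp (MvPolynomial.eval₂Hom c h.coord) =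
        (MvPolynomial.aeval (R := k) (H w)).toRingHom := by
      refine MvPolynomial.ringHom_ext (fun r => ?_) fun i => ?_
      · simp [hc]
      · simp [evalAt_coord]
    exact congrArg (fun f => f p) this
  have hualg : IsAlgebraic (MvPolynomial s k) u := by
    refine isAlgebraic_eval₂ c (fun r => ?_) _ hcoord p
    have : c r = algebraMap (MvPolynomial s k) _ (MvPolynomial.C r) := by
      change _ = θ _
      simp [θ]
    rw [this]
    exact isAlgebraic_algebraMap _
  have hu0 : u = 0 := by
    by_contra hne
    obtain ⟨Q, hQ0, hQ⟩ :=
      hualg.exists_nonzero_coeff_and_aeval_eq_zero (mem_nonZeroDivisors_of_ne_zero hne)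
    have h1 := congrArg (evalAt ⟨y₀, hy₀⟩) hQ
    rw [Polynomial.aeval_def, Polynomial.hom_eval₂, map_zero, hev, hp, Polynomial.eval₂_at_zero]
      at h1
    change ((evalAt ⟨y₀, hy₀⟩).comp θ) (Q.coeff 0) = 0 at h1
    rw [hθ] at h1
    exact hQ0 ((map_eq_zero_iff _ hind).1 h1)
  rw [← hev ⟨w, hw⟩, hu0, map_zero]

/-- The Zariski closure of an analytic graph with algebraic coordinates has the dimension of the
parameter space: the parameters form a transcendence basis of its coordinate ring. -/
theorem ringKrullDim_quotient (h : IsAnalyticGraph H W)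
    (q : Fin d → Polynomial (MvPolynomial s ℝ))
    (hq : ∀ j ∉ s, q j ≠ 0 ∧ ∀ w ∈ W, (q j).eval₂ (MvPolynomial.eval w) (H w j) = 0) :
    ringKrullDim (MvPolynomial (Fin d) ℝ ⧸ MvPolynomial.vanishingIdeal ℝ (H '' W)) =
      (Fintype.card s : ℕ) := by
  set J := MvPolynomial.vanishingIdeal ℝ (H '' W) with hJ
  have hprime : J.IsPrime := h.isPrime_vanishingIdeal
  let B := MvPolynomial (Fin d) ℝ ⧸ J
  let π : MvPolynomial (Fin d) ℝ →ₐ[ℝ] B := Ideal.Quotient.mkₐ ℝ J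
  have hπ : ∀ p, π p = 0 ↔ ∀ w ∈ W, MvPolynomial.eval (H w) p = 0 := by
    intro p
    change Ideal.Quotient.mk J p = 0 ↔ _
    rw [Ideal.Quotient.eq_zero_iff_mem, hJ, MvPolynomial.mem_vanishingIdeal_iff,
      Set.forall_mem_image]
    rfl
  let θ : MvPolynomial s ℝ →ₐ[ℝ] B := π.comp (MvPolynomial.rename Subtype.val)
  -- The parameters are independent in `B`, as a polynomial vanishing on a box is zero.
  have hθinj : Function.Injective θ := by
    rw [injective_iff_map_eq_zero]
    intro a ha
    rw [AlgHom.comp_apply, hπ] at ha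
    obtain ⟨y, hy⟩ := h.nonempty
    obtain ⟨ε, hε, hεW⟩ := Metric.isOpen_iff.1 h.isOpen y hy
    refine MvPolynomial.funext_set (fun i => Metric.ball (y i) ε) (fun i => ?_) fun z hz => ?_
    · rw [Real.ball_eq_Ioo]
      exact Set.Ioo_infinite (by linarith)
    · have hzW : z ∈ W := hεW (by rwa [ball_pi _ hε])
      have := ha z hzW
      rw [MvPolynomial.eval_rename] at this
      rw [map_zero, ← this]
      congr 2
      funext i
      exact (h.proj z hzW i).symm
  let _ := θ.toRingHom.toAlgebra
  have : IsScalarTower ℝ (MvPolynomial s ℝ) B :=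
    IsScalarTower.of_algebraMap_eq fun x => (θ.commutes x).symm
  have : FaithfulSMul (MvPolynomial s ℝ) B := (faithfulSMul_iff_algebraMap_injective _ _).2 hθinj
  have halgX : ∀ j, IsAlgebraic (MvPolynomial s ℝ) (π (MvPolynomial.X j)) := by
    intro j
    by_cases hj : j ∈ s
    · have : π (MvPolynomial.X j) =
          algebraMap (MvPolynomial s ℝ) B (MvPolynomial.X ⟨j, hj⟩) := by
        change _ = θ _
        simp [θ]
      rw [this]
      exact isAlgebraic_algebraMap _
    · refine ⟨q j, (hq j hj).1, ?_⟩
      have h1 : Polynomial.aeval (π (MvPolynomial.X j)) (q j) = π (substVar j (q j)) := by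
        change _ = π.toRingHom (substVar j (q j))
        rw [substVar, Polynomial.hom_eval₂]
        rfl
      rw [h1, hπ]
      intro w hw
      rw [MvPolynomial.eval, eval₂Hom_substVar, ← (hq j hj).2 w hw]
      congr 2
      funext i
      exact h.proj w hw i
  have halg : Algebra.IsAlgebraic (MvPolynomial s ℝ) B := by
    refine ⟨fun b => ?_⟩
    obtain ⟨p, rfl⟩ := Ideal.Quotient.mk_surjective b
    have h1 : Ideal.Quotient.mk J p =
        MvPolynomial.eval₂Hom (algebraMap ℝ B) (fun j => π (MvPolynomial.X j)) p := by
      change π.toRingHom p = _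
      congr 1
      refine MvPolynomial.ringHom_ext (fun r => ?_) fun i => ?_
      · simp only [MvPolynomial.eval₂Hom_C]
        exact π.commutes r
      · simp
    rw [h1]
    refine isAlgebraic_eval₂ _ (fun r => ?_) _ halgX p
    rw [IsScalarTower.algebraMap_apply ℝ (MvPolynomial s ℝ) B]
    exact isAlgebraic_algebraMap _
  have hb := (IsTranscendenceBasis.mvPolynomial s ℝ).algebraMap_comp (A := B)
  exact ringKrullDim_eq_card_of_isTranscendenceBasis (k := ℝ) (B := B) hb

/-- At a point of an analytic graph cut out there by independent equations, the tangent space of the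
Zariski closure projects isomorphically to the parameter space. -/
theorem finrank_zariskiTangentSpace (h : IsAnalyticGraph H W) {A : Set (Fin d → ℝ)}
    (hA : MvPolynomial.vanishingIdeal ℝ A = MvPolynomial.vanishingIdeal ℝ (H '' W))
    {y₀ : s → ℝ} (hy₀ : y₀ ∈ W) (g : Fin d → MvPolynomial (Fin d) ℝ)
    (h0 : ∀ j ∉ s, ∀ w ∈ W, MvPolynomial.eval (H w) (g j) = 0)
    (h1 : ∀ j ∉ s, MvPolynomial.eval (H y₀) (MvPolynomial.pderiv j (g j)) ≠ 0)
    (h2 : ∀ j ∉ s, ∀ l ∉ s, l ≠ j → MvPolynomial.pderiv l (g j) = 0) :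
    Module.finrank ℝ (zariskiTangentSpace A (H y₀)) = Fintype.card s := by
  have hmem : ∀ p, p ∈ MvPolynomial.vanishingIdeal ℝ A ↔
      ∀ w ∈ W, MvPolynomial.eval (H w) p = 0 := by
    intro p
    rw [hA, MvPolynomial.mem_vanishingIdeal_iff, Set.forall_mem_image]
    rfl
  let ρ : zariskiTangentSpace A (H y₀) →ₗ[ℝ] s → ℝ :=
    (LinearMap.funLeft ℝ ℝ (Subtype.val : s → Fin d)).comp (Submodule.subtype _)
  have hρ : ∀ v i, ρ v i = v.1 i := fun v i => rfl
  have hinj : Function.Injective ρ := by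
    rw [← LinearMap.ker_eq_bot, LinearMap.ker_eq_bot']
    rintro ⟨v, hv⟩ hv0
    have hvs : ∀ i ∈ s, v i = 0 := fun i hi => congrFun hv0 ⟨i, hi⟩
    refine Subtype.ext (funext fun j => ?_)
    by_cases hj : j ∈ s
    · exact hvs j hj
    have := hv (g j) ((hmem _).2 (h0 j hj))
    rw [Finset.sum_eq_single j] at this
    · exact (mul_eq_zero.1 this).resolve_left (h1 j hj)
    · intro l _ hl
      by_cases hls : l ∈ s
      · rw [hvs l hls, mul_zero]
      · rw [h2 j hj l hls hl, map_zero, zero_mul]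
    · simp
  -- The differential of the parametrization is a section of the projection.
  have hsurj : Function.Surjective ρ := by
    intro t
    have hderiv : ∀ i, HasFDerivAt (fun y => H y i) (fderiv ℝ (fun y => H y i) y₀) y₀ := fun i =>
      (h.analytic i y₀ hy₀).differentiableAt.hasFDerivAt
    refine ⟨⟨fun i => fderiv ℝ (fun y => H y i) y₀ t, fun p hp => ?_⟩, ?_⟩
    · have hcomp := (hasStrictFDerivAt_eval p (H y₀)).hasFDerivAt.comp y₀ (hasFDerivAt_pi.2 hderiv)
      have hzero : (fun y => MvPolynomial.eval (H y) p) =ᶠ[nhds y₀] fun _ => 0 := by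
        filter_upwards [h.isOpen.mem_nhds hy₀] with y hy
        exact (hmem p).1 hp y hy
      have heq := hcomp.unique ((hasFDerivAt_const (0 : ℝ) y₀).congr_of_eventuallyEq hzero)
      have := congrArg (fun L => L t) heq
      simpa using this
    · funext i
      rw [hρ]
      have hid : (fun y => H y i) =ᶠ[nhds y₀] fun y => y i := by
        filter_upwards [h.isOpen.mem_nhds hy₀] with y hy
        exact h.proj y hy i
      change fderiv ℝ (fun y => H y i) y₀ t = t i
      rw [hid.fderiv_eq]
      have : HasFDerivAt (fun y : s → ℝ => y i)
          (ContinuousLinearMap.proj i : (s → ℝ) →L[ℝ] ℝ) y₀ :=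
        (ContinuousLinearMap.proj i : (s → ℝ) →L[ℝ] ℝ).hasFDerivAt
      rw [this.fderiv]
      rfl
  rw [(LinearEquiv.ofBijective ρ ⟨hinj, hsurj⟩).finrank_eq, Module.finrank_fintype_fun_eq_card]

end IsAnalyticGraph

/-! ### The smallest definable algebraic set -/

/-- By the identity theorem, a polynomial that vanishes on the part of a connected analytic graph
near one of its points vanishes on the graph. -/
theorem IsAnalyticGraph.eval_eq_zero_of_eventually {d : ℕ} {s : Set (Fin d)} [Fintype s]
    {H : (s → ℝ) → Fin d → ℝ} {W : Set (s → ℝ)} (h : IsAnalyticGraph H W) {y₀ : s → ℝ}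
    (hy₀ : y₀ ∈ W) {p : MvPolynomial (Fin d) ℝ}
    (hp : ∀ᶠ y in nhds y₀, MvPolynomial.aeval (H y) p = 0) {w : s → ℝ} (hw : w ∈ W) :
    MvPolynomial.aeval (H w) p = 0 :=
  (AnalyticOnNhd.aeval_mvPolynomial h.analytic p).eqOn_zero_of_preconnected_of_eventuallyEq_zero
    h.isPreconnected hy₀ hp hw

theorem IsAnalyticGraph.continuousAt {d : ℕ} {s : Set (Fin d)} [Fintype s]
    {H : (s → ℝ) → Fin d → ℝ} {W : Set (s → ℝ)} (h : IsAnalyticGraph H W) {y₀ : s → ℝ}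
    (hy₀ : y₀ ∈ W) : ContinuousAt H y₀ :=
  continuousAt_pi.2 fun i => (h.analytic i y₀ hy₀).continuousAt

/-- An `F`-semialgebraic set containing the point of the graph over `y₀` contains the nearby part
of the graph, if the polynomials over the ring generated by `F` vanishing at that point vanish on
the graph. -/
theorem IsAnalyticGraph.eventually_mem {d : ℕ} {s : Set (Fin d)} [Fintype s]
    {H : (s → ℝ) → Fin d → ℝ} {W : Set (s → ℝ)} (h : IsAnalyticGraph H W) {y₀ : s → ℝ}
    (hy₀ : y₀ ∈ W) {F : Set ℝ}
    (hF : ∀ p : MvPolynomial (Fin d) (Subring.closure F),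
      MvPolynomial.aeval (H y₀) p = 0 → ∀ w ∈ W, MvPolynomial.aeval (H w) p = 0)
    {A : Set (Fin d → ℝ)} (hA : IsSemialgebraicOver F A) (hmem : H y₀ ∈ A) :
    ∀ᶠ y in nhds y₀, H y ∈ A := by
  obtain ⟨Q, hQ⟩ := hA.signDetermined
  have key : ∀ q ∈ Q, ∀ᶠ y in nhds y₀, SignType.sign (MvPolynomial.aeval (H y₀) q) =
      SignType.sign (MvPolynomial.aeval (H y) q) := by
    intro q _
    have hc : ContinuousAt (fun y => MvPolynomial.aeval (H y) q) y₀ :=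
      (AnalyticOnNhd.aeval_mvPolynomial h.analytic q y₀ hy₀).continuousAt
    rcases lt_trichotomy (MvPolynomial.aeval (H y₀) q) 0 with hlt | heq | hgt
    · filter_upwards [hc.eventually_lt_const hlt] with y hy
      rw [sign_neg hlt, sign_neg hy]
    · filter_upwards [h.isOpen.mem_nhds hy₀] with y hy
      rw [heq, hF q heq y hy]
    · filter_upwards [hc.eventually_const_lt hgt] with y hy
      rw [sign_pos hgt, sign_pos hy]
  filter_upwards [(Filter.eventually_all_finset Q).2 key] with y hy
  exact hQ _ _ hy hmem

theorem isIrreducibleAlgebraicSet_of_isPrime {d : ℕ} {A : Set (Fin d → ℝ)} (hA : IsAlgebraicSet A)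
    (hprime : (MvPolynomial.vanishingIdeal ℝ A).IsPrime) : IsIrreducibleAlgebraicSet A := by
  refine ⟨hA, ?_⟩
  rintro _ _ ⟨b, rfl⟩ ⟨c, rfl⟩ hBC
  have hmul : b * c ∈ MvPolynomial.vanishingIdeal ℝ A := by
    rw [MvPolynomial.mem_vanishingIdeal_iff]
    intro z hz
    rw [hBC] at hz
    rw [map_mul]
    exact mul_eq_zero.2 hz
  rcases hprime.mem_or_mem hmul with h | h
  · exact Or.inl ((hBC ▸ Set.subset_union_left).antisymm
      fun z hz => (MvPolynomial.mem_vanishingIdeal_iff.1 h) z hz)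
  · exact Or.inr ((hBC ▸ Set.subset_union_right).antisymm
      fun z hz => (MvPolynomial.mem_vanishingIdeal_iff.1 h) z hz)

/-- The smallest algebraic `F`-semialgebraic set through `x` is the Zariski closure of an analytic
graph through `x`. The parameters of the graph are coordinates of `x` forming a transcendence basis
over the ring generated by `F`, so the closure is a point only if `x` is algebraic. -/
theorem exists_isLeast_algebraicDefinableSets {d : ℕ} (F : Set ℝ) (x : Fin d → ℝ) :
    ∃ E : Set (Fin d → ℝ), IsLeast (algebraicDefinableSets F x) E ∧
      (MvPolynomial.vanishingIdeal ℝ E).IsPrime ∧ IsNonsingularPoint E x ∧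
      (E = {x} → ∀ j, IsAlgebraic (Subring.closure F) (x j)) := by
  classical
  set k := Subring.closure F
  obtain ⟨s, hind, hroot⟩ := exists_algebraicIndepOn_and_simple_root k x
  have : Fintype s := Fintype.ofFinite s
  choose! q hq0 hqx hq' using hroot
  let G : Fin d → MvPolynomial (Fin d) k := fun j => substVar j (q j)
  let g : Fin d → MvPolynomial (Fin d) ℝ := fun j => MvPolynomial.map (algebraMap k ℝ) (G j)
  have hG : ∀ z j, MvPolynomial.aeval z (G j) =
      (q j).eval₂ (MvPolynomial.eval₂Hom (algebraMap k ℝ) fun i : s => z i) (z j) :=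
    fun z j => eval₂Hom_substVar j (q j) (algebraMap k ℝ) z
  have hg : ∀ z j, MvPolynomial.eval z (g j) = MvPolynomial.aeval z (G j) := by
    intro z j
    rw [MvPolynomial.eval_map]
    rfl
  have h0 : ∀ j ∉ s, MvPolynomial.eval x (g j) = 0 := fun j hj => by
    rw [hg, hG]
    exact hqx j hj
  have h1 : ∀ j ∉ s, MvPolynomial.eval x (MvPolynomial.pderiv j (g j)) ≠ 0 := fun j hj => by
    rw [MvPolynomial.pderiv_map, pderiv_substVar_self hj, MvPolynomial.eval_map]
    change MvPolynomial.eval₂Hom (algebraMap k ℝ) x _ ≠ 0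
    rw [eval₂Hom_substVar]
    exact hq' j hj
  have h2 : ∀ j ∉ s, ∀ l ∉ s, l ≠ j → MvPolynomial.pderiv l (g j) = 0 := fun j _ l hl hlj => by
    rw [MvPolynomial.pderiv_map, pderiv_substVar_of_ne hl hlj, map_zero]
  obtain ⟨H, W, hWo, hWc, hy₀, hHan, hproj, hHg, hHx, hnear⟩ :=
    exists_analytic_parametrization s x g h0 h1 h2
  set y₀ : s → ℝ := fun i => x i
  have h : IsAnalyticGraph H W := ⟨hWo, hWc, ⟨_, hy₀⟩, hHan, hproj⟩
  have hHG : ∀ j ∉ s, ∀ w ∈ W,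
      (q j).eval₂ (MvPolynomial.eval₂Hom (algebraMap k ℝ) w) (H w j) = 0 := by
    intro j hj w hw
    have := hHg w hw j hj
    rw [hg, hG] at this
    have hw' : (fun i : s => H w i) = w := funext (hproj w hw)
    rwa [hw'] at this
  have hF : ∀ p : MvPolynomial (Fin d) k,
      MvPolynomial.aeval (H y₀) p = 0 → ∀ w ∈ W, MvPolynomial.aeval (H w) p = 0 :=
    fun p hp w hw => h.aeval_eq_zero hy₀ hind q (fun j hj => ⟨hq0 j hj, hHG j hj⟩) hp hw
  set J := MvPolynomial.vanishingIdeal ℝ (H '' W) with hJ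
  have hmemJ : ∀ p, p ∈ J ↔ ∀ w ∈ W, MvPolynomial.aeval (H w) p = 0 := by
    intro p
    rw [hJ, MvPolynomial.mem_vanishingIdeal_iff, Set.forall_mem_image]
  set E := MvPolynomial.zeroLocus ℝ J with hE
  have hEJ : MvPolynomial.vanishingIdeal ℝ E = J :=
    MvPolynomial.zeroLocus_vanishingIdeal_galoisConnection.u_l_u_eq_u (OrderDual.toDual (H '' W))
  have hsub : H '' W ⊆ E := MvPolynomial.zeroLocus_vanishingIdeal_le _
  have hxE : x ∈ E := hHx ▸ hsub ⟨y₀, hy₀, rfl⟩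
  have hEalg : IsAlgebraicSet E := isAlgebraicSet_zeroLocus J
  have hEdef : IsSemialgebraicOver F E := by
    -- `E` is the Zariski closure of its definable subset `S`, a neighbourhood of `x` in the graph.
    obtain ⟨U, hUx, hUsub, hUdef⟩ := exists_definable_nhds_subset F hnear
    set S : Set (Fin d → ℝ) :=
      U ∩ ⋂ j ∈ (Finset.univ.filter (· ∉ s)), {z | MvPolynomial.aeval z (G j) = 0} with hS
    have hmemS : ∀ z, z ∈ S ↔ z ∈ U ∧ ∀ j ∉ s, MvPolynomial.eval z (g j) = 0 := by
      intro z
      simp [hS, hg]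
    have hSdef : F.Definable rcfLang S := by
      refine hUdef.inter ?_
      exact Set.definable_biInter_finset (fun j => definable_aeval_eq_zero F (G j)) _
    have hSJ : MvPolynomial.vanishingIdeal ℝ S = J := by
      ext p
      rw [hmemJ, MvPolynomial.mem_vanishingIdeal_iff]
      constructor
      · intro hp w hw
        refine h.eval_eq_zero_of_eventually hy₀ ?_ hw
        have hHU : ∀ᶠ y in nhds y₀, H y ∈ U := h.continuousAt hy₀ (by rwa [hHx])
        filter_upwards [hHU, hWo.mem_nhds hy₀] with y hyU hyW
        exact hp _ ((hmemS _).2 ⟨hyU, hHg y hyW⟩)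
      · intro hp z hz
        obtain ⟨hzU, hzg⟩ := (hmemS z).1 hz
        obtain ⟨hzW, hHz⟩ := hUsub hzU hzg
        rw [← hHz]
        exact hp _ hzW
    rw [hE, ← hSJ]
    exact IsSemialgebraicOver.zeroLocus_vanishingIdeal hSdef
  refine ⟨E, ⟨⟨hEalg, hEdef, hxE⟩, ?_⟩, hEJ ▸ h.isPrime_vanishingIdeal, ⟨hxE, ?_⟩, ?_⟩
  -- The zero set of `a` contains the graph near `x`, so `a` vanishes on the graph.
  · rintro _ ⟨⟨a, rfl⟩, hdef, hxa⟩ z hz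
    refine hz a ((hmemJ a).2 fun w hw => h.eval_eq_zero_of_eventually hy₀ ?_ hw)
    exact h.eventually_mem hy₀ hF hdef (by rwa [hHx])
  · have hfin := h.finrank_zariskiTangentSpace hEJ hy₀ g (fun j hj w hw => hHg w hw j hj)
      (by rwa [hHx]) h2
    rw [hHx] at hfin
    have hinj : Function.Injective (MvPolynomial.map (σ := s) (algebraMap k ℝ)) :=
      MvPolynomial.map_injective _ Subtype.val_injective
    rw [hfin, algDim, hEJ, h.ringKrullDim_quotient
      (fun j => (q j).map (MvPolynomial.map (algebraMap k ℝ))) fun j hj => ⟨?_, fun w hw => ?_⟩]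
    · exact (Polynomial.map_ne_zero_iff hinj).2 (hq0 j hj)
    · rw [Polynomial.eval₂_map, ← hHG j hj w hw]
      congr 1
      exact MvPolynomial.ringHom_ext (fun r => by simp) fun i => by simp
  -- The projection of the graph is the open set `W`, so `W` is a point and `s` is empty.
  · intro hEx
    have hs : IsEmpty s := by
      by_contra hne
      rw [not_isEmpty_iff] at hne
      have hW : W = {y₀} := by
        refine Set.Subset.antisymm (fun w hw => ?_) (Set.singleton_subset_iff.2 hy₀)
        have hHw : H w = x := by
          have : H w ∈ E := hsub ⟨w, hw, rfl⟩
          rwa [hEx] at this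
        exact funext fun i => by rw [← hproj w hw, hHw]
      exact not_isOpen_singleton y₀ (hW ▸ hWo)
    intro j
    have hj : j ∉ s := fun hj => hs.elim ⟨j, hj⟩
    let e := MvPolynomial.isEmptyAlgEquiv k s
    have he : ∀ r : k, e (MvPolynomial.C r) = r := fun r => e.commutes r
    refine ⟨(q j).map e.toRingHom, ?_, ?_⟩
    · exact (Polynomial.map_ne_zero_iff e.injective).2 (hq0 j hj)
    · rw [Polynomial.aeval_def, Polynomial.eval₂_map, ← hqx j hj]
      congr 1
      exact MvPolynomial.ringHom_ext (fun r => by simp [he]) fun i => hs.elim i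

theorem D_eq_of_isLeast {d : ℕ} {F : Set ℝ} {x : Fin d → ℝ} {E : Set (Fin d → ℝ)}
    (hE : IsLeast (algebraicDefinableSets F x) E) : D F x = E :=
  (Set.sInter_subset_of_mem hE.1).antisymm (Set.subset_sInter hE.2)

theorem singleton_mem_algebraicDefinableSets {d : ℕ} {F : Set ℝ} {x : Fin d → ℝ}
    (hx : ∀ i, x i ∈ F) : {x} ∈ algebraicDefinableSets F x := by
  refine ⟨⟨∑ i, (MvPolynomial.X i - MvPolynomial.C (x i)) ^ 2, ?_⟩, ?_, rfl⟩
  · ext z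
    simp only [Set.mem_singleton_iff, Set.mem_ofPred_eq, map_sum, map_pow, map_sub,
      MvPolynomial.eval_X, MvPolynomial.eval_C]
    rw [Finset.sum_eq_zero_iff_of_nonneg fun i _ => sq_nonneg _, funext_iff]
    simp [sub_eq_zero]
  · let p : Fin d → MvPolynomial (Fin d) (Subring.closure F) := fun i =>
      MvPolynomial.X i - MvPolynomial.C ⟨x i, Subring.subset_closure (hx i)⟩
    have hp : F.Definable rcfLang (⋂ i, {z : Fin d → ℝ | MvPolynomial.aeval z (p i) = 0}) :=
      Set.definable_iInter_of_finite fun i => definable_aeval_eq_zero F (p i)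
    refine (congrArg (F.Definable rcfLang) ?_).mp hp
    ext z
    simp only [p, Set.mem_iInter, Set.mem_ofPred_eq, map_sub, MvPolynomial.aeval_X,
      MvPolynomial.aeval_C, sub_eq_zero, Set.mem_singleton_iff, funext_iff]
    rfl

end RealAlg

theorem mainTheorem7 (d : ℕ) (F : Set ℝ) (x : Fin d → ℝ) :
    IsLeast (RealAlg.algebraicDefinableSets F x) (RealAlg.D F x) ∧
    RealAlg.IsIrreducibleAlgebraicSet (RealAlg.D F x) ∧
    RealAlg.IsNonsingularPoint (RealAlg.D F x) x ∧
    (∀ K : Subfield ℝ, (K : Set ℝ) = F → IsRealClosed K →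
      (RealAlg.D F x = {x} ↔ ∀ i, x i ∈ F)) := by
  obtain ⟨E, hE, hprime, hns, halg⟩ := RealAlg.exists_isLeast_algebraicDefinableSets F x
  rw [RealAlg.D_eq_of_isLeast hE]
  refine ⟨hE, RealAlg.isIrreducibleAlgebraicSet_of_isPrime hE.1.1 hprime, hns, ?_⟩
  rintro K rfl hK
  constructor
  · intro hEx j
    have hle : Subring.closure (K : Set ℝ) ≤ K.toSubring := Subring.closure_le.2 fun _ h => h
    obtain ⟨r, hr0, hr⟩ := halg hEx j
    refine RealAlg.mem_of_isAlgebraic_of_isRealClosed K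
      ⟨r.map (Subring.inclusion hle), ?_, ?_⟩
    · exact (Polynomial.map_ne_zero_iff (Subring.inclusion_injective hle)).2 hr0
    · rw [Polynomial.aeval_def, ← hr, Polynomial.aeval_def]
      exact Polynomial.eval₂_map _ _ _
  · intro hx
    exact (hE.2 (RealAlg.singleton_mem_algebraicDefinableSets hx)).antisymm
      (Set.singleton_subset_iff.2 hE.1.2.2)
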